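/- Let $n\ge 2$. Let $W(B_n)$ be the Coxeter group with generators $s_1,\dots,s_n$, where $m(s_1,s_2)=4$, $m(s_i,s_{i+1})=3$ for $2\le i\le n-1$, and $m(s_i,s_j)=2$ for $|i-j|\ge 2$. Let $W(B'_n)$ be the Coxeter group with generators $s_2,\dots,s_{n+1}$, where $m(s_n,s_{n+1})=4$, $m(s_i,s_{i+1})=3$ for $2\le i\le n-1$, and $m(s_i,s_j)=2$ for $|i-j|\ge 2$. In a Coxeter system $(W,S)$ with length function $l$, an element is fully commutative if any two of its reduced expressions can be transformed into each other by moves $st\mapsto ts$ of adjacent letters with $m(s,t)=2$. The support $\mathrm{supp}(w)$ is the set of generators occurring in reduced expressions of $w$. A fully commutative $w$ is left weak star reducible if there are $s,t\in S$ with $m(s,t)\ge 3$, $l(sw)<l(w)$, $l(tsw)<l(sw)$ and $tw$ not fully commutative; it is right weak star reducible if there are $s,t\in S$ with $m(s,t)\ge 3$, $l(ws)<l(w)$, $l(wst)<l(ws)$ and $wt$ not fully commutative. A fully commutative $w$ is non-cancellable if it is neither left nor right weak star reducible. A product of commuting generators is a (possibly empty) product of distinct, pairwise commuting elements of $S$.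 Theorem. (a) A fully commutative $w\in W(B_n)$ is non-cancellable if and only if $w$ is a product of commuting generators, or $w=s_1s_2u$ or $w=s_2s_1u$ for some product of commuting generators $u\in W(B_n)$ with $s_1,s_2,s_3\notin\mathrm{supp}(u)$. (b) A fully commutative $w\in W(B'_n)$ is non-cancellable if and only if $w$ is a product of commuting generators, or $w=s_{n+1}s_nu$ or $w=s_ns_{n+1}u$ for some product of commuting generators $u\in W(B'_n)$ with $s_{n+1},s_n,s_{n-1}\notin\mathrm{supp}(u)$. (For $n=2$ the conditions $s_3\notin\mathrm{supp}(u)$ in (a) and $s_1\notin\mathrm{supp}(u)$ in (b) are void.) -/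

import Mathlib

/-- The order `m(s_i, s_j)` in the Coxeter graph of type affine `C_n`, which is the path
`s_1 - s_2 - ⋯ - s_n - s_{n+1}` whose first edge `{s_1, s_2}` and last edge `{s_n, s_{n+1}}` are
labelled `4`, all other edges being labelled `3`. -/
def affineCEntry (n i j : ℕ) : ℕ :=
  if i = j then 1
  else if i + 1 = j ∨ j + 1 = i then
    if min i j = 1 ∨ max i j = n + 1 then 4 else 3
  else 2

/-- The Coxeter matrix obtained from the graph of type affine `C_n` by keeping only the
generators `s_i` with `i ∈ I`. -/
def affineCRestrict (n : ℕ) (I : Set ℕ) : CoxeterMatrix I where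
  M := Matrix.of fun i j : I => affineCEntry n i j
  isSymm := by
    ext i j
    simp only [Matrix.transpose_apply, Matrix.of_apply, affineCEntry, min_comm (i : ℕ) j,
      max_comm (i : ℕ) j, eq_comm (a := (i : ℕ)) (b := j),
      or_comm (a := (i : ℕ) + 1 = j)]
  diagonal i := by simp [affineCEntry]
  off_diagonal i j h := by
    have h' : (i : ℕ) ≠ j := fun e => h (Subtype.ext e)
    simp only [Matrix.of_apply, affineCEntry, if_neg h']
    split_ifs <;> decide

/-- Type `B_n`: generators `s_1, …, s_n`. -/
def typeB (n : ℕ) : CoxeterMatrix (Set.Icc 1 n) := affineCRestrict n (Set.Icc 1 n)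

/-- Type `B'_n`: generators `s_2, …, s_{n+1}`. -/
def typeB' (n : ℕ) : CoxeterMatrix (Set.Icc 2 (n + 1)) := affineCRestrict n (Set.Icc 2 (n + 1))

namespace CoxeterSystem

variable {B : Type*} {M : CoxeterMatrix B} {W : Type*} [Group W] (cs : CoxeterSystem M W)

/-- `ω` is a reduced expression for `w`. -/
def IsReducedExpr (w : W) (ω : List B) : Prop := cs.IsReduced ω ∧ cs.wordProd ω = w

/-- The support of `w`: the generators that occur in its reduced expressions. -/
def support (w : W) : Set B := {i | ∃ ω, cs.IsReducedExpr w ω ∧ i ∈ ω}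

/-- A single commutation move `⋯ s t ⋯ ↦ ⋯ t s ⋯` with `m(s, t) = 2`. -/
def CommMove (M : CoxeterMatrix B) (ω ω' : List B) : Prop :=
  ∃ (a b : List B) (i j : B), M i j = 2 ∧ ω = a ++ i :: j :: b ∧ ω' = a ++ j :: i :: b

/-- `w` is fully commutative: its reduced expressions form a single commutation class. -/
def IsFullyCommutative (w : W) : Prop :=
  ∀ ω ω' : List B, cs.IsReducedExpr w ω → cs.IsReducedExpr w ω' →
    Relation.ReflTransGen (CommMove M) ω ω'

/-- `w` is left star reducible by `s_i` with respect to `s_j`. The condition `m(s_i, s_j) ≥ 3`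
includes `m(s_i, s_j) = ∞`, which is encoded in a Coxeter matrix as `0`. -/
def IsLeftStarReducible (w : W) (i j : B) : Prop :=
  cs.IsLeftDescent w i ∧ cs.IsLeftDescent (cs.simple i * w) j ∧ (3 ≤ M i j ∨ M i j = 0)

/-- `w` is right star reducible by `s_i` with respect to `s_j`. -/
def IsRightStarReducible (w : W) (i j : B) : Prop :=
  cs.IsRightDescent w i ∧ cs.IsRightDescent (w * cs.simple i) j ∧ (3 ≤ M i j ∨ M i j = 0)

/-- The fully commutative element `w` is left weak star reducible by `s_i` with respect to
`s_j`. -/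
def IsLeftWeakStarReducible (w : W) (i j : B) : Prop :=
  cs.IsFullyCommutative w ∧ cs.IsLeftStarReducible w i j ∧
    ¬ cs.IsFullyCommutative (cs.simple j * w)

/-- The fully commutative element `w` is right weak star reducible by `s_i` with respect to
`s_j`. -/
def IsRightWeakStarReducible (w : W) (i j : B) : Prop :=
  cs.IsFullyCommutative w ∧ cs.IsRightStarReducible w i j ∧
    ¬ cs.IsFullyCommutative (w * cs.simple j)

/-- `w` is non-cancellable (weak star irreducible). -/
def IsNonCancellable (w : W) : Prop :=
  cs.IsFullyCommutative w ∧
    ¬ ∃ i j : B, cs.IsLeftWeakStarReducible w i j ∨ cs.IsRightWeakStarReducible w i j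

/-- `w` is a (possibly empty) product of distinct, pairwise commuting generators. -/
def IsProdCommGenerators (w : W) : Prop :=
  ∃ ω : List B, ω.Pairwise (fun i j => M i j = 2) ∧ cs.wordProd ω = w

end CoxeterSystem

/-! Both groups are handled at once. A map `f` labels the generators by vertices of the path 1 - 2 -
3 - ⋯ whose first edge has weight 4. For `typeB` it is the index itself, for `typeB'` the index
counted from the other end. The theorem is then `isNonCancellable_iff` for any such labelling that
attains the labels 1 and 2.

Only the listed elements are non-cancellable. The label word of a reduced expression of a fully
commutative element contains, up to commutations, no square and no long braid (`BraidFree`). If `w`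
has a reduced word starting with `i j` and m(i,j) = 3, or with `i j i` and m(i,j) = 4, then `s_j w`
has a reduced word starting with a long braid, so it is not fully commutative and `w` is left weak
star reducible. Non-cancellability therefore forbids such beginnings (`LeftIrreducible`) and,
applied to the inverse, such endings. What remains is combinatorics of words. In a braid-free word,
consecutive occurrences of a label are tightly constrained by the neighbouring labels. Together with
irreducibility at both ends this shows that two adjacent labels ≥ 2 never both occur
(`BraidFree.not_adjacent`) and that no label repeats (`BraidFree.nodup`). Only the pair 1, 2 can
fail to commute, and it then splits off on the left.

All the listed elements are non-cancellable. Such an element is represented by a word `X ++ υ`, with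
`X` alternating in the labels 1 and 2 and `υ` commuting with everything. The exchange property, with
a representation by signed permutations that tells the generators apart and shows that s₁s₂s₁ and
s₂s₁s₂ are not generators, determines all left descents (`IsSplitWord.eq_of_isLeftDescent`).
Reducedness and full commutativity follow for `X` of length at most 3. Length 3 is exactly what is
needed, since the only candidate for a weak star reduction turns s_i s_j υ into s_j s_i s_j υ. -/

namespace CoxeterSystem

variable {B : Type*} {M : CoxeterMatrix B} {W : Type*} [Group W] (cs : CoxeterSystem M W)

/-! ### The exchange property, through the action on signed reflections. -/

theorem reverse_alternatingWord_two_mul (i j : B) (m : ℕ) :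
    (alternatingWord i j (2 * m)).reverse = alternatingWord j i (2 * m) := by
  apply List.ext_getElem
  · simp
  · intro k h₁ h₂
    simp only [List.length_reverse, length_alternatingWord] at h₁
    rw [List.getElem_reverse, getElem_alternatingWord _ _ _ _ (by simp; lia),
      getElem_alternatingWord _ _ _ _ (by lia)]
    simp only [length_alternatingWord]
    grind

theorem prod_map_alternatingWord_two_mul {G : Type*} [Monoid G] (f : B → G) (i j : B) (m : ℕ) :
    ((alternatingWord i j (2 * m)).map f).prod = (f i * f j) ^ m := by
  induction m with
  | zero => simp [alternatingWord]
  | succ m ih =>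
    have h : alternatingWord i j (2 * (m + 1)) = i :: j :: alternatingWord i j (2 * m) := by
      rw [show 2 * (m + 1) = 2 * m + 1 + 1 by ring, alternatingWord_succ', alternatingWord_succ']
      simp
    rw [h, pow_succ']
    simp [ih, mul_assoc]

/-- The entry at position `k` depends only on the `k`-th power of a product of two generators, whose
`M i j`-th power is trivial, so the sequence has period `M i j`. For infinite order, encoded as 0,
the word is empty. -/
theorem leftInvSeq_alternatingWord_braid (i j : B) :
    ∃ L, cs.leftInvSeq (alternatingWord i j (2 * M i j)) = L ++ L := by
  set L := cs.leftInvSeq (alternatingWord i j (2 * M i j)) with hL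
  have hlen : L.length = 2 * M i j := by simp [hL]
  refine ⟨L.take (M i j), ?_⟩
  conv_lhs => rw [← List.take_append_drop (M i j) L]
  congr 1
  apply List.ext_getElem
  · simp [hlen]; lia
  · intro k h₁ h₂
    simp only [List.length_take, hlen] at h₂
    rw [List.getElem_drop, List.getElem_take]
    simp only [hL]
    rw [cs.getElem_leftInvSeq_alternatingWord _ _ _ _ (by lia),
      cs.getElem_leftInvSeq_alternatingWord _ _ _ _ (by lia),
      prod_alternatingWord_eq_mul_pow, prod_alternatingWord_eq_mul_pow]
    have e1 : (2 * (M i j + k) + 1) / 2 = M i j + k := by lia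
    have e2 : (2 * k + 1) / 2 = k := by lia
    rw [e1, e2, pow_add, cs.simple_mul_simple_pow']
    simp

open Classical in
/-- The action of a simple reflection on signed group elements, underlying the strong exchange
property. -/
noncomputable def signedConj (i : B) : Equiv.Perm (W × ZMod 2) :=
  Function.Involutive.toPerm
    (fun p => (cs.simple i * p.1 * cs.simple i, p.2 + if p.1 = cs.simple i then 1 else 0)) (by
      rintro ⟨t, e⟩
      have h : cs.simple i * t * cs.simple i = cs.simple i ↔ t = cs.simple i := by
        constructor
        · intro h
          have := congrArg (fun x => cs.simple i * x * cs.simple i) h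
          simpa [mul_assoc] using this
        · rintro rfl
          simp
      ext
      · simp [mul_assoc]
      · simp only [h]
        split_ifs
        · rw [add_assoc, show (1 + 1 : ZMod 2) = 0 from rfl, add_zero]
        · simp)

open Classical in
theorem signedConj_apply (i : B) (t : W) (e : ZMod 2) :
    cs.signedConj i (t, e) =
      (cs.simple i * t * cs.simple i, e + if t = cs.simple i then 1 else 0) :=
  rfl

open Classical in
-- The sign records the parity of the number of occurrences of `t` in the inversion sequence. Once
-- the action is known to factor through `W`, this parity is an invariant of the group element.
theorem prod_map_signedConj_apply (ω : List B) (t : W) (e : ZMod 2) :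
    (ω.map cs.signedConj).prod (t, e) =
      (cs.wordProd ω * t * (cs.wordProd ω)⁻¹, e + ((cs.rightInvSeq ω).count t : ZMod 2)) := by
  induction ω with
  | nil => simp
  | cons i ω ih =>
    have h : cs.wordProd ω * t * (cs.wordProd ω)⁻¹ = cs.simple i ↔
        (cs.wordProd ω)⁻¹ * cs.simple i * cs.wordProd ω = t := by
      constructor
      · intro h
        rw [← h]
        group
      · rintro rfl
        group
    rw [List.map_cons, List.prod_cons, Equiv.Perm.mul_apply, ih, signedConj_apply]
    ext
    · simp [wordProd_cons, mul_assoc]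
    · simp only [h, rightInvSeq, List.count_cons, beq_iff_eq]
      split_ifs <;> simp [add_assoc]

/-- A braid relator has a doubled inversion sequence, so it changes every sign an even number of
times. -/
theorem isLiftable_signedConj : M.IsLiftable cs.signedConj := by
  classical
  intro i j
  rw [← prod_map_alternatingWord_two_mul]
  ext1 ⟨t, e⟩
  rw [prod_map_signedConj_apply]
  have hc : cs.wordProd (alternatingWord i j (2 * M i j)) = 1 := by
    have := prod_map_alternatingWord_two_mul cs.simple i j (M i j)
    rw [cs.simple_mul_simple_pow] at this
    exact this
  obtain ⟨L, hL⟩ := cs.leftInvSeq_alternatingWord_braid j i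
  have hr : cs.rightInvSeq (alternatingWord i j (2 * M i j)) = (L ++ L).reverse := by
    rw [← hL, M.symmetric j i, ← reverse_alternatingWord_two_mul, rightInvSeq_reverse]
  have h2 : ∀ x : ZMod 2, x + x = 0 := by decide
  rw [hc, hr]
  simp [List.count_append, h2]

open Classical in
theorem count_rightInvSeq_eq_of_wordProd_eq {ω ω' : List B}
    (h : cs.wordProd ω = cs.wordProd ω') (t : W) :
    ((cs.rightInvSeq ω).count t : ZMod 2) = (cs.rightInvSeq ω').count t := by
  have key : ∀ ω : List B, cs.lift ⟨_, cs.isLiftable_signedConj⟩ (cs.wordProd ω) =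
      (ω.map cs.signedConj).prod := by
    intro ω
    rw [wordProd, map_list_prod, List.map_map]
    congr 2
    ext1 i
    simp [cs.lift_apply_simple cs.isLiftable_signedConj]
  have h1 := (key ω).symm.trans ((congrArg _ h).trans (key ω'))
  have h2 := congrArg (fun g => (g (t, 0)).2) h1
  simpa only [prod_map_signedConj_apply, zero_add] using h2

/-- A reduced word of the same element that ends in `i` contains the reflection exactly once. By
invariance of the parity, its number of occurrences in `ω` is odd, hence nonzero. -/
theorem simple_mem_rightInvSeq {ω : List B} {i : B}
    (h : cs.IsRightDescent (cs.wordProd ω) i) : cs.simple i ∈ cs.rightInvSeq ω := by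
  classical
  obtain ⟨τ, hτ, hτw⟩ := cs.exists_isReduced (cs.wordProd ω * cs.simple i)
  have hp : cs.wordProd (τ.concat i) = cs.wordProd ω := by
    rw [wordProd_concat, ← hτw]; simp
  have hred : cs.IsReduced (τ.concat i) := by
    rw [isRightDescent_iff, hτw, hτ.eq] at h
    rw [IsReduced, hp, List.length_concat]
    exact h.symm
  have hmem : cs.simple i ∈ cs.rightInvSeq (τ.concat i) := by
    rw [rightInvSeq_concat]; simp
  have h1 : (cs.rightInvSeq (τ.concat i)).count (cs.simple i) = 1 :=
    List.count_eq_one_of_mem hred.nodup_rightInvSeq hmem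
  have h2 := cs.count_rightInvSeq_eq_of_wordProd_eq hp (cs.simple i)
  rw [h1] at h2
  by_contra hn
  rw [List.count_eq_zero_of_not_mem hn] at h2
  exact absurd h2 (by decide)

/-- The exchange property: a left descent of `π ω` is obtained by conjugating some letter of `ω`
by the part of `ω` that precedes it. -/
theorem exists_eq_conj_of_isLeftDescent {ω : List B} {i : B}
    (h : cs.IsLeftDescent (cs.wordProd ω) i) :
    ∃ a k b, ω = a ++ k :: b ∧
      cs.simple i = cs.wordProd a * cs.simple k * (cs.wordProd a)⁻¹ := by
  have h' : cs.IsRightDescent (cs.wordProd ω.reverse) i := by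
    rwa [wordProd_reverse, isRightDescent_inv_iff]
  have hm := cs.simple_mem_rightInvSeq h'
  rw [rightInvSeq_reverse, List.mem_reverse] at hm
  obtain ⟨j, hj, hji⟩ := List.mem_iff_getElem.mp hm
  rw [length_leftInvSeq] at hj
  refine ⟨ω.take j, ω[j], ω.drop (j + 1), by simp, ?_⟩
  rw [← hji, getElem_leftInvSeq _ _ _ hj]

end CoxeterSystem

/-! ### Signed permutations representing the path with first edge labelled 4. -/

/-- The entries of the Coxeter matrix of the half-infinite path `1 - 2 - 3 - ⋯` whose first edge is
labelled `4` and whose other edges are labelled `3`. -/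
def pathEntry (a b : ℕ) : ℕ :=
  if a = b then 1
  else if a + 1 = b ∨ b + 1 = a then
    if min a b = 1 then 4 else 3
  else 2

/-- The signed transposition of `ℤ` attached to the vertex `k ≥ 1` of the half-infinite path. -/
def signedSwap (k : ℕ) : Equiv.Perm ℤ :=
  if k = 1 then Equiv.swap 1 (-1)
  else Equiv.swap (k : ℤ) (k - 1) * Equiv.swap (-k : ℤ) (1 - k)

theorem signedSwap_apply {k : ℕ} (hk : 1 ≤ k) (x : ℤ) :
    signedSwap k x =
      if k = 1 then (if x = 1 then -1 else if x = -1 then 1 else x)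
      else if x = k then k - 1 else if x = k - 1 then k
      else if x = -k then 1 - k else if x = 1 - k then -k else x := by
  unfold signedSwap
  split_ifs <;> simp only [Equiv.Perm.mul_apply, Equiv.swap_apply_def] <;> grind

theorem signedSwap_mul_self {k : ℕ} (hk : 1 ≤ k) : signedSwap k * signedSwap k = 1 := by
  ext x
  rw [Equiv.Perm.mul_apply, signedSwap_apply hk, signedSwap_apply hk, Equiv.Perm.one_apply]
  grind

theorem signedSwap_commute {a b : ℕ} (ha : 1 ≤ a) (hab : a + 1 < b) :
    signedSwap a * signedSwap b = signedSwap b * signedSwap a := by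
  apply Equiv.Perm.Disjoint.commute
  intro x
  rw [signedSwap_apply ha, signedSwap_apply (k := b) (by lia)]
  by_cases h : x = b ∨ x = b - 1 ∨ x = -b ∨ x = 1 - b
  · left
    grind
  · right
    grind

theorem signedSwap_braid {a : ℕ} (ha : 2 ≤ a) :
    signedSwap a * signedSwap (a + 1) * signedSwap a =
      signedSwap (a + 1) * signedSwap a * signedSwap (a + 1) := by
  ext x
  have h1 := fun y => signedSwap_apply (k := a) (by lia) y
  have h2 := fun y => signedSwap_apply (k := a + 1) (by lia) y
  simp only [if_neg (show a ≠ 1 by lia)] at h1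
  simp only [if_neg (show a + 1 ≠ 1 by lia)] at h2
  push_cast at h2
  have a1 : signedSwap a a = a - 1 := by grind
  have a2 : signedSwap a (a - 1) = a := by grind
  have a3 : signedSwap a (-a) = 1 - a := by grind
  have a4 : signedSwap a (1 - a) = -a := by grind
  have a5 : signedSwap a (a + 1) = a + 1 := by grind
  have a6 : signedSwap a (-1 - a) = -1 - a := by grind
  have b1 : signedSwap (a + 1) (a + 1) = a := by grind
  have b2 : signedSwap (a + 1) a = a + 1 := by grind
  have b3 : signedSwap (a + 1) (-1 - a) = -a := by grind
  have b4 : signedSwap (a + 1) (-a) = -1 - a := by grind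
  have b5 : signedSwap (a + 1) (a - 1) = a - 1 := by grind
  have b6 : signedSwap (a + 1) (1 - a) = 1 - a := by grind
  simp only [Equiv.Perm.mul_apply]
  by_cases hx : x = a ∨ x = a - 1 ∨ x = a + 1 ∨ x = -a ∨ x = 1 - a ∨ x = -1 - a
  · rcases hx with h | h | h | h | h | h <;> subst h <;>
      simp only [a1, a2, a3, a4, a5, a6, b1, b2, b3, b4, b5, b6]
  · have e1 : signedSwap a x = x := by grind
    have e2 : signedSwap (a + 1) x = x := by grind
    rw [e1, e2, e1, e2]

theorem signedSwap_braid_one_two :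
    signedSwap 1 * signedSwap 2 * signedSwap 1 * signedSwap 2 =
      signedSwap 2 * signedSwap 1 * signedSwap 2 * signedSwap 1 := by
  ext x
  have h1 := fun y => signedSwap_apply (k := 1) (by lia) y
  have h2 := fun y => signedSwap_apply (k := 2) (by lia) y
  norm_num at h1 h2
  simp only [Equiv.Perm.mul_apply]
  by_cases hx : x = 1 ∨ x = 2 ∨ x = -1 ∨ x = -2
  · rcases hx with h | h | h | h <;> subst h <;> norm_num [h1, h2]
  · have e1 : signedSwap 1 x = x := by grind
    have e2 : signedSwap 2 x = x := by grind
    simp only [e1, e2]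

theorem signedSwap_mul_pow_pathEntry {a b : ℕ} (ha : 1 ≤ a) (hb : 1 ≤ b) :
    (signedSwap a * signedSwap b) ^ pathEntry a b = 1 := by
  have sq := @signedSwap_mul_self
  have inv : ∀ k, 1 ≤ k → (signedSwap k)⁻¹ = signedSwap k := fun k hk =>
    inv_eq_of_mul_eq_one_left (sq hk)
  wlog hab : a ≤ b generalizing a b
  · have h := this hb ha (by lia)
    have e : pathEntry b a = pathEntry a b := by
      unfold pathEntry; grind
    rw [e] at h
    -- Inverting the relation exchanges the two involutions, which reduces to `a ≤ b`.
    have h2 := congrArg (·⁻¹) h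
    simpa [← inv_pow, inv a ha, inv b hb] using h2
  unfold pathEntry
  split_ifs with h1 h2 h3
  · subst h1; simp [sq ha]
  · obtain rfl : a = 1 := by lia
    obtain rfl : b = 2 := by lia
    have := signedSwap_braid_one_two
    calc (signedSwap 1 * signedSwap 2) ^ 4
        = (signedSwap 1 * signedSwap 2 * signedSwap 1 * signedSwap 2) *
          (signedSwap 1 * signedSwap 2 * signedSwap 1 * signedSwap 2) := by
          simp only [pow_succ, pow_zero, one_mul, mul_assoc]
      _ = (signedSwap 1 * signedSwap 2 * signedSwap 1 * signedSwap 2) *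
          (signedSwap 1 * signedSwap 2 * signedSwap 1 * signedSwap 2)⁻¹ := by
          congr 1
          simp only [mul_inv_rev, inv 1 ha, inv 2 hb]
          simpa only [mul_assoc] using this
      _ = 1 := mul_inv_cancel _
  · obtain rfl : b = a + 1 := by lia
    have := signedSwap_braid (a := a) (by lia)
    calc (signedSwap a * signedSwap (a + 1)) ^ 3
        = (signedSwap a * signedSwap (a + 1) * signedSwap a) *
          (signedSwap (a + 1) * signedSwap a * signedSwap (a + 1)) := by
          simp only [pow_succ, pow_zero, one_mul, mul_assoc]
      _ = (signedSwap a * signedSwap (a + 1) * signedSwap a) *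
          (signedSwap a * signedSwap (a + 1) * signedSwap a)⁻¹ := by
          rw [← this]
          congr 1
          simp only [mul_inv_rev, inv a ha, inv (a + 1) hb, mul_assoc]
      _ = 1 := mul_inv_cancel _
  · have := signedSwap_commute (a := a) (b := b) ha (by lia)
    calc (signedSwap a * signedSwap b) ^ 2
        = signedSwap a * signedSwap b * (signedSwap b * signedSwap a) := by
          rw [pow_two, this]
      _ = 1 := by
        rw [mul_assoc, ← mul_assoc (signedSwap b), sq hb, one_mul, sq ha]

theorem signedSwap_injective {a b : ℕ} (ha : 1 ≤ a) (hb : 1 ≤ b)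
    (h : signedSwap a = signedSwap b) : a = b := by
  wlog hab : a ≤ b generalizing a b
  · exact (this hb ha h.symm (by lia)).symm
  by_contra hne
  -- For `a < b`, the point `b` is fixed by `signedSwap a` and moved by `signedSwap b`.
  have := congrArg (fun g => g (b : ℤ)) h
  simp only [signedSwap_apply ha, signedSwap_apply hb] at this
  grind

/-- The left side sends 1 to -2, whereas a generator sends 1 to 1, -1 or 2. -/
theorem signedSwap_one_two_one_ne {a : ℕ} (ha : 1 ≤ a) :
    signedSwap 1 * signedSwap 2 * signedSwap 1 ≠ signedSwap a := by
  intro h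
  have := congrArg (fun g => g (1 : ℤ)) h
  simp only [Equiv.Perm.mul_apply, signedSwap_apply ha, signedSwap_apply (le_refl 1),
    signedSwap_apply (k := 2) (by lia)] at this
  norm_num at this
  grind

/-- The left side sends 2 to -2, whereas a generator sends 2 to 1, 2 or 3. -/
theorem signedSwap_two_one_two_ne {a : ℕ} (ha : 1 ≤ a) :
    signedSwap 2 * signedSwap 1 * signedSwap 2 ≠ signedSwap a := by
  intro h
  have := congrArg (fun g => g (2 : ℤ)) h
  simp only [Equiv.Perm.mul_apply, signedSwap_apply ha, signedSwap_apply (le_refl 1),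
    signedSwap_apply (k := 2) (by lia)] at this
  norm_num at this
  grind

/-! ### Combinatorics of braid-free words of labels. -/

/-- `k` is neither equal nor adjacent to any letter of `a`. -/
def Apart (k : ℕ) (a : List ℕ) : Prop := ∀ x ∈ a, x + 1 < k ∨ k + 1 < x

theorem apart_succ {k : ℕ} {a : List ℕ} (h0 : k ∉ a) (h1 : k + 1 ∉ a) (h2 : k + 2 ∉ a) :
    Apart (k + 1) a := by
  intro x hx
  by_contra h
  obtain rfl | rfl | rfl : x = k ∨ x = k + 1 ∨ x = k + 2 := by lia
  all_goals contradiction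

theorem Apart.append {k : ℕ} {a b : List ℕ} (ha : Apart k a) (hb : Apart k b) :
    Apart k (a ++ b) := by
  intro x hx
  rcases List.mem_append.mp hx with h | h
  exacts [ha x h, hb x h]

theorem Apart.reverse {k : ℕ} {a : List ℕ} (ha : Apart k a) : Apart k a.reverse :=
  fun x hx => ha x (List.mem_reverse.mp hx)

theorem List.exists_first {α : Type*} {k : α} {l : List α} (h : k ∈ l) :
    ∃ u v, l = u ++ k :: v ∧ k ∉ u :=
  List.eq_append_cons_of_mem h

theorem List.exists_last {α : Type*} {k : α} {l : List α} (h : k ∈ l) :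
    ∃ u v, l = u ++ k :: v ∧ k ∉ v := by
  obtain ⟨u, v, h1, h2⟩ := List.eq_append_cons_of_mem (List.mem_reverse.mpr h)
  refine ⟨v.reverse, u.reverse, ?_, by simpa using h2⟩
  have := congrArg List.reverse h1
  simpa using this

theorem List.exists_gap_of_not_nodup {α : Type*} {l : List α} (h : ¬ l.Nodup) :
    ∃ k u a v, l = u ++ k :: (a ++ k :: v) ∧ k ∉ u ∧ k ∉ a := by
  classical
  have : ∃ k, 2 ≤ l.count k := by
    by_contra! hc
    exact h (List.nodup_iff_count_le_one.mpr fun k => by have := hc k; lia)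
  obtain ⟨k, hk⟩ := this
  obtain ⟨u, v, rfl, hu⟩ := List.exists_first (k := k) (l := l)
    (List.count_pos_iff.mp (by lia))
  have hv : k ∈ v := by
    apply List.count_pos_iff.mp
    rw [List.count_append, List.count_eq_zero_of_not_mem hu, List.count_cons_self] at hk
    lia
  obtain ⟨a, v, rfl, ha⟩ := List.exists_first hv
  exact ⟨k, u, a, v, rfl, hu, ha⟩

/-- The conditions satisfied by the word of labels of a reduced expression of a fully commutative
element: no commutation-equivalent word contains a square or a long braid. -/
structure BraidFree (l : List ℕ) : Prop where
  pos : 0 ∉ l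
  no_square : ∀ u a v k, l = u ++ k :: (a ++ k :: v) → ¬ Apart k a
  no_braid : ∀ u a b v j k, l = u ++ k :: (a ++ j :: (b ++ k :: v)) → 2 ≤ j → 2 ≤ k →
    (j + 1 = k ∨ k + 1 = j) → Apart k a → ¬ Apart k b
  no_long_braid : ∀ u a b c v j k, l = u ++ j :: (a ++ k :: (b ++ j :: (c ++ k :: v))) →
    (j = 1 ∧ k = 2 ∨ j = 2 ∧ k = 1) → Apart j a → Apart j b → Apart k b → ¬ Apart k c

/-- The conditions imposed on a word of labels by the absence of a left weak star reduction. -/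
structure LeftIrreducible (l : List ℕ) : Prop where
  no_edge : ∀ u a v j k, l = u ++ k :: (a ++ j :: v) → 2 ≤ j → 2 ≤ k →
    (j + 1 = k ∨ k + 1 = j) → Apart k u → Apart j u → ¬ Apart j a
  no_double_edge : ∀ u a b v j k, l = u ++ j :: (a ++ k :: (b ++ j :: v)) →
    (j = 1 ∧ k = 2 ∨ j = 2 ∧ k = 1) → Apart j u → Apart k u → Apart j a → Apart k a → ¬ Apart j b

namespace BraidFree

variable {l : List ℕ}

theorem reverse (h : BraidFree l) : BraidFree l.reverse where
  pos := by simpa using h.pos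
  no_square u a v k hl ha := by
    refine h.no_square v.reverse a.reverse u.reverse k ?_ ha.reverse
    simpa using congrArg List.reverse hl
  no_braid u a b v j k hl hj hk hjk ha hb := by
    refine h.no_braid v.reverse b.reverse a.reverse u.reverse j k ?_ hj hk hjk hb.reverse ha.reverse
    simpa using congrArg List.reverse hl
  no_long_braid u a b c v j k hl hjk ha hb hb' hc := by
    -- Reversing j k j k gives k j k j, so the two labels exchange roles.
    refine h.no_long_braid v.reverse c.reverse b.reverse a.reverse u.reverse k j ?_ (by lia)
      hc.reverse hb'.reverse hb.reverse ha.reverse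
    simpa using congrArg List.reverse hl

/-- Two consecutive occurrences of `k + 1` are separated by an occurrence of `k`. -/
theorem pred_mem_gap (h : BraidFree l) {k : ℕ} (hk : 1 ≤ k) {u b v : List ℕ}
    (hl : l = u ++ (k + 1) :: (b ++ (k + 1) :: v)) (hb : k + 1 ∉ b) : k ∈ b := by
  obtain ⟨N, hN⟩ : ∃ N, ∀ x ∈ l, x ≤ N := ⟨l.sum, fun x hx => List.le_sum_of_mem hx⟩
  -- The induction descends from the largest labels, where the claim is vacuous, to the smaller
  -- ones.
  induction hd : N - k generalizing k u b v with
  | zero =>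
    have := hN (k + 1) (by simp [hl])
    lia
  | succ d ih =>
    by_contra hkb
    -- If `k` is missing, count the `k + 2` in the gap: none leaves a square, exactly one leaves a
    -- braid, and two consecutive ones would enclose a `k + 1` by induction.
    by_cases h2 : k + 2 ∈ b
    · obtain ⟨b1, b2, rfl, h1⟩ := List.exists_first h2
      by_cases h3 : k + 2 ∈ b2
      · obtain ⟨b3, b4, rfl, h4⟩ := List.exists_first h3
        have := ih (k := k + 1) (u := u ++ (k + 1) :: b1) (b := b3) (v := b4 ++ (k + 1) :: v)
          (by lia) (by simp [hl]) h4 (by lia)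
        simp_all
      · simp only [List.mem_append, List.mem_cons, not_or] at hb hkb
        exact h.no_braid u b1 b2 v (k + 2) (k + 1) (by simp [hl]) (by lia) (by lia) (by lia)
          (apart_succ hkb.1 hb.1 h1) (apart_succ hkb.2.2 hb.2.2 h3)
    · exact h.no_square u b v (k + 1) hl (apart_succ hkb hb h2)

/-- Two consecutive occurrences of `k` are separated by at most one occurrence of `k + 1`. -/
theorem succ_not_mem_of_gap (h : BraidFree l) {k : ℕ} (hk : 1 ≤ k) {u b c v : List ℕ}
    (hl : l = u ++ k :: (b ++ (k + 1) :: (c ++ k :: v))) (hb : k ∉ b) (hc : k ∉ c) :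
    k + 1 ∉ b ∧ k + 1 ∉ c := by
  constructor <;> intro hm
  · obtain ⟨b1, b2, rfl, h2⟩ := List.exists_last hm
    have := h.pred_mem_gap hk (u := u ++ k :: b1) (b := b2) (v := c ++ k :: v) (by simp [hl]) h2
    simp_all
  · obtain ⟨c1, c2, rfl, h2⟩ := List.exists_first hm
    have := h.pred_mem_gap hk (u := u ++ k :: b) (b := c1) (v := c2 ++ k :: v) (by simp [hl]) h2
    simp_all

theorem two_mem_gap_one (h : BraidFree l) {u b v : List ℕ}
    (hl : l = u ++ 1 :: (b ++ 1 :: v)) (hb : 1 ∉ b) : 2 ∈ b := by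
  by_contra h2
  have hp := h.pos
  exact h.no_square u b v 1 hl (apart_succ (by simp_all) hb h2)

theorem one_not_mem_of_gap_two (h : BraidFree l) {u b c v : List ℕ}
    (hl : l = u ++ 2 :: (b ++ 1 :: (c ++ 2 :: v))) (hb : 2 ∉ b) (hc : 2 ∉ c) :
    1 ∉ b ∧ 1 ∉ c := by
  constructor <;> intro hm
  · obtain ⟨b1, b2, rfl, h2⟩ := List.exists_last hm
    have := h.two_mem_gap_one (u := u ++ 2 :: b1) (b := b2) (v := c ++ 2 :: v) (by simp [hl]) h2
    simp_all
  · obtain ⟨c1, c2, rfl, h2⟩ := List.exists_first hm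
    have := h.two_mem_gap_one (u := u ++ 2 :: b) (b := c1) (v := c2 ++ 2 :: v) (by simp [hl]) h2
    simp_all

/-- If `k + 2` is absent between two consecutive occurrences of `k + 1`, then `k` and `k + 1` do
not occur before them. -/
theorem not_mem_before_gap (h : BraidFree l) {k : ℕ} (hk : 1 ≤ k) {u b v : List ℕ}
    (hl : l = u ++ (k + 1) :: (b ++ (k + 1) :: v)) (hb : k + 1 ∉ b) (hb' : k + 2 ∉ b) :
    k ∉ u ∧ k + 1 ∉ u := by
  induction k, hk using Nat.le_induction generalizing u b v with
  | base =>
    have h1 := h.pred_mem_gap le_rfl hl hb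
    obtain ⟨b1, b2, rfl, -⟩ := List.exists_first h1
    simp only [List.mem_append, List.mem_cons, not_or] at hb hb'
    have hn := h.one_not_mem_of_gap_two (u := u) (b := b1) (c := b2) (v := v) (by simp [hl])
      hb.1 hb.2.2
    have hp := h.pos
    have hu : 1 ∉ u := by
      intro hm
      obtain ⟨u1, u2, rfl, h2⟩ := List.exists_last hm
      have hs := h.succ_not_mem_of_gap (k := 1) le_rfl (u := u1) (b := u2) (c := b1)
        (v := b2 ++ 2 :: v) (by simp [hl]) h2 hn.1
      -- The last 1 before the gap, together with the 2 1 2 of the gap, forms the long braid 1 2 1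
      -- 2.
      refine h.no_long_braid u1 u2 b1 b2 v 1 2 (by simp [hl]) (by lia)
        (apart_succ ?_ h2 hs.1) (apart_succ ?_ hn.1 hs.2) (apart_succ hn.1 hb.1 hb'.1)
        (apart_succ hn.2 hb.2.2 hb'.2.2)
      all_goals simp_all
    refine ⟨hu, fun hm => ?_⟩
    obtain ⟨u1, u2, rfl, h2⟩ := List.exists_last hm
    have := h.pred_mem_gap le_rfl (u := u1) (b := u2) (v := b1 ++ 1 :: b2 ++ 2 :: v)
      (by simp [hl]) h2
    simp_all
  | succ k hk ih =>
    have h1 := h.pred_mem_gap (by lia) hl hb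
    obtain ⟨b1, b2, rfl, h2⟩ := List.exists_first h1
    simp only [List.mem_append, List.mem_cons, not_or] at hb hb'
    -- A single `k + 1` in the gap would give a braid. The first two occurrences enclose no `k + 2`,
    -- so the induction hypothesis applies to them.
    have h3 : k + 1 ∈ b2 := by
      by_contra h3
      exact h.no_braid u b1 b2 v (k + 1) (k + 2) (by simp [hl]) (by lia) (by lia) (by lia)
        (apart_succ h2 hb.1 hb'.1) (apart_succ h3 hb.2.2 hb'.2.2)
    obtain ⟨b3, b4, rfl, h4⟩ := List.exists_first h3
    have h5 := ih (u := u ++ (k + 2) :: b1) (b := b3) (v := b4 ++ (k + 2) :: v) (by simp [hl]) h4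
      (by simp_all)
    have hu : k + 1 ∉ u := by simp_all
    refine ⟨hu, fun hm => ?_⟩
    obtain ⟨u1, u2, rfl, h6⟩ := List.exists_last hm
    have := h.pred_mem_gap (k := k + 1) (by lia) (u := u1) (b := u2)
      (v := b1 ++ (k + 1) :: (b3 ++ (k + 1) :: b4) ++ (k + 2) :: v) (by simp [hl]) h6
    simp_all

theorem not_mem_after_gap (h : BraidFree l) {k : ℕ} (hk : 1 ≤ k) {u b v : List ℕ}
    (hl : l = u ++ (k + 1) :: (b ++ (k + 1) :: v)) (hb : k + 1 ∉ b) (hb' : k + 2 ∉ b) :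
    k ∉ v ∧ k + 1 ∉ v := by
  have := h.reverse.not_mem_before_gap hk (u := v.reverse) (b := b.reverse) (v := u.reverse)
    (by simp [hl]) (by simpa using hb) (by simpa using hb')
  simpa using this

/-- One occurrence of `k + 1` is forced by `pred_mem_gap`; if it were the only one, it would form a
braid with the ends of the gap. -/
theorem exists_pred_gap (h : BraidFree l) {k : ℕ} (hk : 1 ≤ k) {u b v : List ℕ}
    (hl : l = u ++ (k + 2) :: (b ++ (k + 2) :: v)) (hb : k + 2 ∉ b) (hb' : k + 3 ∉ b) :
    ∃ b1 b2 b3, b = b1 ++ (k + 1) :: (b2 ++ (k + 1) :: b3) ∧ k + 1 ∉ b1 ∧ k + 1 ∉ b2 := by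
  have h1 := h.pred_mem_gap (by lia) hl hb
  obtain ⟨b1, b2, rfl, h2⟩ := List.exists_first h1
  simp only [List.mem_append, List.mem_cons, not_or] at hb hb'
  have h3 : k + 1 ∈ b2 := by
    by_contra h3
    exact h.no_braid u b1 b2 v (k + 1) (k + 2) (by simp [hl]) (by lia) (by lia) (by lia)
      (apart_succ h2 hb.1 hb'.1) (apart_succ h3 hb.2.2 hb'.2.2)
  obtain ⟨b3, b4, rfl, h4⟩ := List.exists_first h3
  exact ⟨b1, b3, b4, rfl, h2, h4⟩

/-- For `k = 1` the hypotheses are contradictory, because consecutive 1s enclose a 2. For larger `k`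
this is `not_mem_after_gap`. -/
theorem not_mem_of_gap (h : BraidFree l) {k : ℕ} (hk : 1 ≤ k) {u b v : List ℕ}
    (hl : l = u ++ k :: (b ++ k :: v)) (hb : k ∉ b) (hb' : k + 1 ∉ b) : k ∉ v := by
  obtain rfl | ⟨k, rfl⟩ : k = 1 ∨ ∃ j, k = j + 1 + 1 := by
    obtain _ | _ | k := k <;> simp_all
  · exact absurd (h.two_mem_gap_one hl hb) hb'
  · exact (h.not_mem_after_gap (by lia) hl hb hb').2

/-- A word without left weak star reductions does not start, up to commutations, with
`k, k + 1, k` where the first `k + 1` is not preceded by `k + 2`. -/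
theorem not_starts_with_peak (h : BraidFree l) (hL : LeftIrreducible l) {k : ℕ} (hk : 1 ≤ k)
    {a b c d : List ℕ} (hl : l = a ++ k :: (b ++ (k + 1) :: (c ++ k :: d)))
    (ha0 : k ∉ a) (ha1 : k + 1 ∉ a) (ha2 : k + 2 ∉ a)
    (hb0 : k ∉ b) (hb1 : k + 1 ∉ b) (hb2 : k + 2 ∉ b) (hc : k ∉ c) : False := by
  have hp := h.pos
  have hc1 := (h.succ_not_mem_of_gap hk hl hb0 hc).2
  induction k, hk using Nat.le_induction generalizing a b c d with
  | base =>
    -- At the bottom the peak is 1 2 1, which commutes to the front and is itself forbidden there.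
    refine hL.no_double_edge a b c d 1 2 hl (by lia) (apart_succ ?_ ha0 ha1)
      (apart_succ ha0 ha1 ha2) (apart_succ ?_ hb0 hb1) (apart_succ hb0 hb1 hb2)
      (apart_succ ?_ hc hc1)
    all_goals simp_all
  | succ k hk ih =>
    -- Otherwise the word would start with `k + 1, k + 2`. This `k` and the one forced between the
    -- two `k + 1` form a peak one label lower, so the argument descends.
    have h1 : k ∈ a := by
      by_contra h1
      exact hL.no_edge a b (c ++ (k + 1) :: d) (k + 2) (k + 1) (by simp [hl]) (by lia) (by lia)
        (by lia) (apart_succ h1 ha0 ha1) (apart_succ ha0 ha1 ha2) (apart_succ hb0 hb1 hb2)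
    obtain ⟨a1, a2, rfl, h2⟩ := List.exists_first h1
    have h3 : k ∈ b ++ (k + 2) :: c :=
      h.pred_mem_gap hk (u := a1 ++ k :: a2) (v := d) (by simp [hl]) (by simp [hb0, hc])
    simp only [List.mem_append, List.mem_cons, not_or] at ha0 ha1 ha2
    -- Two consecutive `k` before the first `k + 1` would exclude any later `k`, against `h3`.
    have h4 : k ∉ a2 := by
      intro h4
      obtain ⟨a3, a4, rfl, h5⟩ := List.exists_first h4
      have := h.not_mem_of_gap hk (u := a1) (b := a3)
        (v := a4 ++ (k + 1) :: (b ++ (k + 2) :: (c ++ (k + 1) :: d))) (by simp [hl]) h5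
        (by simp_all)
      simp at this h3
      lia
    obtain ⟨c1, c2, h5, h6⟩ := List.exists_first h3
    have hl' : l = a1 ++ k :: (a2 ++ (k + 1) :: (c1 ++ k :: (c2 ++ (k + 1) :: d))) := by
      have : b ++ (k + 2) :: (c ++ (k + 1) :: d) = c1 ++ k :: (c2 ++ (k + 1) :: d) := by
        have := congrArg (· ++ (k + 1) :: d) h5
        simpa using this
      simp [hl, this]
    exact ih hl' h2 ha0.1 ha1.1 h4 ha0.2.2 ha1.2.2 h6
      (h.succ_not_mem_of_gap hk hl' h4 h6).2

/-- Suppose `m + 1` occurs left of the unique `m + 2`. If it occurs there twice, neither `m` nor `m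
+ 1` can follow, so the word ends with `m + 1, m + 2`. If it occurs there once and again on the
right, there is a peak at `m + 1`. If it occurs nowhere else, irreducibility at both ends forces an
`m` on either side of it, hence a peak at `m`. -/
theorem not_mem_left_of_last_label (h : BraidFree l) (hL : LeftIrreducible l)
    (hR : LeftIrreducible l.reverse) {m : ℕ} (hm : 1 ≤ m) {u v : List ℕ}
    (hl : l = u ++ (m + 2) :: v) (hu2 : m + 2 ∉ u) (hv2 : m + 2 ∉ v) (hN : m + 3 ∉ l) :
    m + 1 ∉ u := by
  intro hmu
  simp only [hl, List.mem_append, List.mem_cons, not_or] at hN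
  obtain ⟨u1, u2, rfl, h1⟩ := List.exists_first hmu
  simp only [List.mem_append, List.mem_cons, not_or] at hN hu2
  by_cases h2 : m + 1 ∈ u2
  · obtain ⟨u3, u4, rfl, h3⟩ := List.exists_first h2
    have h4 := h.not_mem_after_gap hm (u := u1) (b := u3) (v := u4 ++ (m + 2) :: v)
      (by simp [hl]) h3 (by simp_all)
    simp only [List.mem_append, List.mem_cons, not_or] at h4 hN hu2
    refine hR.no_edge v.reverse u4.reverse (u1 ++ (m + 1) :: u3).reverse (m + 1) (m + 2)
      (by simp [hl]) (by lia) (by lia) (by lia) (Apart.reverse ?_) (Apart.reverse ?_)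
      (Apart.reverse ?_) <;> apply apart_succ <;> simp_all
  · by_cases h3 : m + 1 ∈ v
    · obtain ⟨v1, v2, rfl, h4⟩ := List.exists_first h3
      exact h.not_starts_with_peak hL (k := m + 1) (by lia) (a := u1) (b := u2) (c := v1) (d := v2)
        (by simp [hl]) h1 hu2.1 hN.1.1 h2 hu2.2.2 hN.1.2.2 h4
    · have h4 : m ∈ u1 := by
        by_contra h4
        refine hL.no_edge u1 u2 v (m + 2) (m + 1) (by simp [hl]) (by lia) (by lia) (by lia)
          ?_ ?_ ?_ <;> apply apart_succ <;> simp_all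
      have h5 : m ∈ u2 ++ (m + 2) :: v := by
        by_contra h5
        simp only [List.mem_append, List.mem_cons, not_or] at h5
        refine hR.no_edge v.reverse u2.reverse u1.reverse (m + 1) (m + 2) (by simp [hl]) (by lia)
          (by lia) (by lia) (Apart.reverse ?_) (Apart.reverse ?_) (Apart.reverse ?_) <;>
          apply apart_succ <;> simp_all
      obtain ⟨x1, x2, rfl, h6⟩ := List.exists_first h4
      simp only [List.mem_append, List.mem_cons, not_or] at h1 hu2 hN
      have h7 : m ∉ x2 := by
        intro h7
        obtain ⟨x3, x4, rfl, h8⟩ := List.exists_first h7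
        have := h.not_mem_of_gap hm (u := x1) (b := x3)
          (v := x4 ++ (m + 1) :: (u2 ++ (m + 2) :: v)) (by simp [hl]) h8 (by simp_all)
        simp at this h5
        lia
      obtain ⟨c1, c2, h8, h9⟩ := List.exists_first h5
      exact h.not_starts_with_peak hL hm (a := x1) (b := x2) (c := c1) (d := c2)
        (by simp [hl, h8]) h6 h1.1 hu2.1.1 h7 h1.2.2 hu2.1.2.2 h9

/-- If `m + 2` repeats, its first gap encloses two `m + 1`, and nothing before them prevents the
word from starting with `m + 2, m + 1`. If it occurs once, the one-sided statement applies to the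
word and to its reverse. -/
theorem not_adjacent_of_last_label (h : BraidFree l) (hL : LeftIrreducible l)
    (hR : LeftIrreducible l.reverse) {m : ℕ} (hm : 1 ≤ m) (h2 : m + 2 ∈ l) (h3 : m + 3 ∉ l) :
    m + 1 ∉ l := by
  obtain ⟨u, v, rfl, hu⟩ := List.exists_first h2
  by_cases hv : m + 2 ∈ v
  · exfalso
    obtain ⟨b, v, rfl, hb⟩ := List.exists_first hv
    simp only [List.mem_append, List.mem_cons, not_or] at h3
    have h4 := h.not_mem_before_gap (k := m + 1) (by lia) rfl hb h3.2.2.1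
    obtain ⟨b1, b2, b3, rfl, h5, h6⟩ := h.exists_pred_gap hm rfl hb h3.2.2.1
    have h7 := h.not_mem_before_gap hm (u := u ++ (m + 2) :: b1) (b := b2)
      (v := b3 ++ (m + 2) :: v) (by simp) h6 (by simp_all)
    refine hL.no_edge u b1 (b2 ++ (m + 1) :: b3 ++ (m + 2) :: v) (m + 1) (m + 2) (by simp)
      (by lia) (by lia) (by lia) ?_ ?_ ?_ <;> apply apart_succ <;> simp_all
  · have h4 := h.not_mem_left_of_last_label hL hR hm rfl hu hv h3
    have h5 := h.reverse.not_mem_left_of_last_label hR (by simpa using hL) hm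
      (u := v.reverse) (v := u.reverse) (by simp) (by simpa using hv) (by simpa using hu)
      (by simpa [and_comm] using h3)
    simp_all

theorem not_adjacent (h : BraidFree l) (hL : LeftIrreducible l)
    (hR : LeftIrreducible l.reverse) {m : ℕ} (hm : 1 ≤ m) (h2 : m + 2 ∈ l) : m + 1 ∉ l := by
  obtain ⟨N, hN⟩ : ∃ N, ∀ x ∈ l, x ≤ N := ⟨l.sum, fun x hx => List.le_sum_of_mem hx⟩
  -- The induction again descends from large labels: if `m + 3` occurs, then `m + 2` is already
  -- excluded.
  induction hd : N - m generalizing m with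
  | zero =>
    have := hN _ h2
    lia
  | succ d ih =>
    by_cases h3 : m + 3 ∈ l
    · exact absurd h2 (ih (m := m + 1) (by lia) h3 (by lia))
    · exact h.not_adjacent_of_last_label hL hR hm h2 h3

/-- A repeated label `k ≥ 3` has no neighbouring label in the word and gives a square. A repeated 1
or 2 gives a pattern j k j in the labels 1 and 2: it extends to a long braid if `k` occurs earlier,
and otherwise it commutes to the front. -/
theorem nodup (h : BraidFree l) (hL : LeftIrreducible l) (hR : LeftIrreducible l.reverse) :
    l.Nodup := by
  by_contra hn
  have hadj : ∀ m, 1 ≤ m → m + 2 ∈ l → m + 1 ∉ l := fun m hm => h.not_adjacent hL hR hm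
  have hp := h.pos
  obtain ⟨k, u, b, v, hl, hu, hb⟩ := List.exists_gap_of_not_nodup hn
  have key : ∀ j k b1 b2, (j = 1 ∧ k = 2 ∨ j = 2 ∧ k = 1) →
      l = u ++ j :: (b1 ++ k :: (b2 ++ j :: v)) → j ∉ u → j ∉ b1 → j ∉ b2 →
      k ∉ b1 → k ∉ b2 → False := by
    intro j k b1 b2 hjk hl hju hj1 hj2 hk1 hk2
    have h2 : 2 ∈ l := by rcases hjk with ⟨rfl, rfl⟩ | ⟨rfl, rfl⟩ <;> simp [hl]
    have h3 : 3 ∉ l := fun h3 => hadj 1 le_rfl h3 h2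
    have apart : ∀ s : List ℕ, (∀ x ∈ s, x ∈ l) → j ∉ s → k ∉ s → Apart j s ∧ Apart k s := by
      intro s hs hj hk
      have h0' : 0 ∉ s := fun hm => hp (hs _ hm)
      have h3' : 3 ∉ s := fun hm => h3 (hs _ hm)
      rcases hjk with ⟨rfl, rfl⟩ | ⟨rfl, rfl⟩
      · exact ⟨apart_succ h0' hj hk, apart_succ hj hk h3'⟩
      · exact ⟨apart_succ hk hj h3', apart_succ h0' hk hj⟩
    have a1 := apart b1 (by simp +contextual [hl]) hj1 hk1
    have a2 := apart b2 (by simp +contextual [hl]) hj2 hk2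
    by_cases hku : k ∈ u
    · obtain ⟨u1, u2, rfl, hk3⟩ := List.exists_last hku
      have a3 := apart u2 (by simp +contextual [hl]) (by simp_all) hk3
      exact h.no_long_braid u1 u2 b1 b2 v k j (by simp [hl]) (by lia) a3.2 a1.2 a1.1 a2.1
    · have a3 := apart u (by simp +contextual [hl]) hju hku
      exact hL.no_double_edge u b1 b2 v j k hl hjk a3.1 a3.2 a1.1 a1.2 a2.1
  obtain rfl | rfl | ⟨m, hm, rfl⟩ : k = 1 ∨ k = 2 ∨ ∃ m, 1 ≤ m ∧ k = m + 2 := by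
    obtain _ | _ | _ | k := k
    · simp [hl] at hp
    · simp
    · simp
    · exact Or.inr (Or.inr ⟨k + 1, by lia, rfl⟩)
  · obtain ⟨b1, b2, rfl, -⟩ := List.exists_first (h.two_mem_gap_one hl hb)
    simp only [List.mem_append, List.mem_cons, not_or] at hb
    have hl' : l = u ++ 1 :: (b1 ++ 2 :: (b2 ++ 1 :: v)) := by simp [hl]
    have h2 := h.succ_not_mem_of_gap le_rfl hl' hb.1 hb.2.2
    exact key 1 2 b1 b2 (by simp) hl' hu hb.1 hb.2.2 h2.1 h2.2
  · obtain ⟨b1, b2, rfl, -⟩ := List.exists_first (h.pred_mem_gap le_rfl hl hb)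
    simp only [List.mem_append, List.mem_cons, not_or] at hb
    have hl' : l = u ++ 2 :: (b1 ++ 1 :: (b2 ++ 2 :: v)) := by simp [hl]
    have h2 := h.one_not_mem_of_gap_two hl' hb.1 hb.2.2
    exact key 2 1 b1 b2 (by simp) hl' hu hb.1 hb.2.2 h2.1 h2.2
  · have hk : m + 2 ∈ l := by simp [hl]
    refine h.no_square u b v _ hl (apart_succ (fun hm' => hadj m hm hk ?_) hb
      (fun hm' => hadj (m + 1) (by lia) ?_ hk)) <;> simp_all

end BraidFree

/-! ### Commutation classes, fully commutative and non-cancellable elements. -/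

namespace CoxeterSystem

section Words

variable {B : Type*} {M : CoxeterMatrix B}

theorem CommMove.perm {ω ω' : List B} (h : CommMove M ω ω') : ω.Perm ω' := by
  obtain ⟨a, b, i, j, -, rfl, rfl⟩ := h
  exact (List.Perm.swap j i b).append_left a

theorem CommMove.reverse {ω ω' : List B} (h : CommMove M ω ω') :
    CommMove M ω.reverse ω'.reverse := by
  obtain ⟨a, b, i, j, hij, rfl, rfl⟩ := h
  exact ⟨b.reverse, a.reverse, j, i, by rwa [M.symmetric], by simp, by simp⟩

theorem CommMove.cons {ω ω' : List B} (h : CommMove M ω ω') (k : B) :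
    CommMove M (k :: ω) (k :: ω') := by
  obtain ⟨a, b, i, j, hij, rfl, rfl⟩ := h
  exact ⟨k :: a, b, i, j, hij, rfl, rfl⟩

theorem perm_of_reflTransGen_commMove {ω ω' : List B}
    (h : Relation.ReflTransGen (CommMove M) ω ω') : ω.Perm ω' := by
  induction h with
  | refl => exact .refl _
  | tail _ h ih => exact ih.trans h.perm

theorem reflTransGen_commMove_symm {ω ω' : List B}
    (h : Relation.ReflTransGen (CommMove M) ω ω') : Relation.ReflTransGen (CommMove M) ω' ω := by
  have hs : Std.Symm (CommMove M) := ⟨by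
    rintro _ _ ⟨a, b, i, j, hij, rfl, rfl⟩
    exact ⟨a, b, j, i, by rwa [M.symmetric], rfl, rfl⟩⟩
  exact (Relation.ReflTransGen.stdSymm (r := CommMove M)).symm _ _ h

theorem reflTransGen_commMove_cons {ω ω' : List B}
    (h : Relation.ReflTransGen (CommMove M) ω ω') (k : B) :
    Relation.ReflTransGen (CommMove M) (k :: ω) (k :: ω') :=
  h.lift _ fun _ _ h => h.cons k

theorem reflTransGen_commMove_reverse {ω ω' : List B}
    (h : Relation.ReflTransGen (CommMove M) ω ω') :
    Relation.ReflTransGen (CommMove M) ω.reverse ω'.reverse :=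
  h.lift _ fun _ _ h => h.reverse

/-- Commutation moves preserve the projection of a word to any two non-commuting generators. -/
theorem filter_eq_of_reflTransGen_commMove [DecidableEq B] {ω ω' : List B}
    (h : Relation.ReflTransGen (CommMove M) ω ω') {i j : B} (hij : M i j ≠ 2) :
    ω.filter (fun x => x = i ∨ x = j) = ω'.filter (fun x => x = i ∨ x = j) := by
  induction h with
  | refl => rfl
  | tail _ h ih =>
    rw [ih]
    obtain ⟨a, b, k, l, hkl, rfl, rfl⟩ := h
    have hji : M j i ≠ 2 := by rwa [M.symmetric]
    have hd : ∀ x, M x x ≠ 2 := by simp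
    simp only [List.filter_append, List.filter_cons]
    congr 1
    by_cases hk : k = i ∨ k = j
    · by_cases hl : l = i ∨ l = j
      · exfalso
        rcases hk with rfl | rfl <;> rcases hl with rfl | rfl
        exacts [hd _ hkl, hij hkl, hji hkl, hd _ hkl]
      · simp [hl]
    · simp [hk]

theorem reflTransGen_commMove_middle {a b : List B} {i : B} (h : ∀ x ∈ a, M x i = 2) :
    Relation.ReflTransGen (CommMove M) (a ++ i :: b) (i :: (a ++ b)) := by
  induction a with
  | nil => exact .refl
  | cons x a ih =>
    refine (reflTransGen_commMove_cons (ih fun y hy => h y (by simp [hy])) x).tail ?_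
    exact ⟨[], a ++ b, x, i, h x (by simp), rfl, rfl⟩

end Words

variable {B : Type*} {M : CoxeterMatrix B} {W : Type*} [Group W] (cs : CoxeterSystem M W)

theorem simple_commute {i j : B} (h : M i j = 2) : Commute (cs.simple i) (cs.simple j) := by
  have h1 := cs.simple_mul_simple_pow i j
  rw [h, pow_two, mul_eq_one_iff_eq_inv, mul_inv_rev, inv_simple, inv_simple] at h1
  exact h1

theorem simple_braid {i j : B} (h : M i j = 3) :
    cs.simple i * cs.simple j * cs.simple i = cs.simple j * cs.simple i * cs.simple j := by
  have h1 := cs.simple_mul_simple_pow i j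
  rw [h, pow_succ', pow_two, mul_eq_one_iff_eq_inv] at h1
  have h2 := congrArg (· * cs.simple i) h1
  simpa [mul_assoc] using h2

theorem simple_long_braid {i j : B} (h : M i j = 4) :
    cs.simple i * cs.simple j * cs.simple i * cs.simple j =
      cs.simple j * cs.simple i * cs.simple j * cs.simple i := by
  have h1 := cs.simple_mul_simple_pow i j
  rw [h, show 4 = 2 + 2 from rfl, pow_add, mul_eq_one_iff_eq_inv, pow_two] at h1
  simpa [mul_assoc] using h1

theorem wordProd_eq_of_reflTransGen_commMove {ω ω' : List B}
    (h : Relation.ReflTransGen (CommMove M) ω ω') : cs.wordProd ω = cs.wordProd ω' := by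
  induction h with
  | refl => rfl
  | tail _ h ih =>
    rw [ih]
    obtain ⟨a, b, i, j, hij, rfl, rfl⟩ := h
    simp only [wordProd_append, wordProd_cons, ← mul_assoc]
    rw [mul_assoc (cs.wordProd a), (cs.simple_commute hij).eq, ← mul_assoc]

variable {cs}

theorem IsReducedExpr.of_wordProd_eq {w : W} {ω ω' : List B} (h : cs.IsReducedExpr w ω)
    (hp : cs.wordProd ω' = cs.wordProd ω) (hl : ω'.length = ω.length) :
    cs.IsReducedExpr w ω' :=
  ⟨by rw [IsReduced, hp, h.1.eq, hl], hp.trans h.2⟩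

theorem IsReducedExpr.of_commMove {w : W} {ω ω' : List B} (h : cs.IsReducedExpr w ω)
    (hc : Relation.ReflTransGen (CommMove M) ω ω') : cs.IsReducedExpr w ω' :=
  h.of_wordProd_eq (cs.wordProd_eq_of_reflTransGen_commMove hc).symm
    (perm_of_reflTransGen_commMove hc).length_eq.symm

theorem IsReducedExpr.reverse {w : W} {ω : List B} (h : cs.IsReducedExpr w ω) :
    cs.IsReducedExpr w⁻¹ ω.reverse :=
  ⟨h.1.reverse, by rw [wordProd_reverse, h.2]⟩

theorem IsReducedExpr.tail {w : W} {i : B} {ω : List B} (h : cs.IsReducedExpr w (i :: ω)) :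
    cs.IsReducedExpr (cs.simple i * w) ω :=
  ⟨h.1.drop 1, by rw [← h.2, wordProd_cons, simple_mul_simple_cancel_left]⟩

theorem IsReducedExpr.isLeftDescent {w : W} {i : B} {ω : List B}
    (h : cs.IsReducedExpr w (i :: ω)) : cs.IsLeftDescent w i := by
  rw [IsLeftDescent, ← h.tail.2, ← h.2, h.tail.1.eq, h.1.eq]
  simp

theorem IsReducedExpr.cons {w : W} {i : B} {ω : List B} (h : cs.IsReducedExpr w ω)
    (hi : ¬ cs.IsLeftDescent w i) : cs.IsReducedExpr (cs.simple i * w) (i :: ω) := by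
  refine ⟨?_, by rw [wordProd_cons, h.2]⟩
  rw [not_isLeftDescent_iff] at hi
  rw [IsReduced, wordProd_cons, h.2, hi, ← h.2, h.1.eq, List.length_cons]

variable (cs) in
theorem exists_isReducedExpr (w : W) : ∃ ω, cs.IsReducedExpr w ω := by
  obtain ⟨ω, h1, h2⟩ := cs.exists_isReduced w
  exact ⟨ω, h1, h2.symm⟩

theorem IsLeftDescent.exists_isReducedExpr {w : W} {i : B} (h : cs.IsLeftDescent w i) :
    ∃ ω, cs.IsReducedExpr w (i :: ω) := by
  obtain ⟨ω, hω⟩ := cs.exists_isReducedExpr (cs.simple i * w)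
  have h1 := hω.cons (i := i) (by
    have := (cs.isLeftDescent_iff_not_isLeftDescent_mul).mp h
    exact this)
  rw [simple_mul_simple_cancel_left] at h1
  exact ⟨ω, h1⟩

theorem IsFullyCommutative.inv {w : W} (h : cs.IsFullyCommutative w) :
    cs.IsFullyCommutative w⁻¹ := by
  intro ω ω' hω hω'
  have h1 := hω.reverse
  have h2 := hω'.reverse
  rw [inv_inv] at h1 h2
  simpa using reflTransGen_commMove_reverse (h _ _ h1 h2)

theorem IsFullyCommutative.filter_eq [DecidableEq B] {w : W} (h : cs.IsFullyCommutative w)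
    {ω ω' : List B} (hω : cs.IsReducedExpr w ω) (hω' : cs.IsReducedExpr w ω') {i j : B}
    (hij : M i j ≠ 2) :
    ω.filter (fun x => x = i ∨ x = j) = ω'.filter (fun x => x = i ∨ x = j) :=
  filter_eq_of_reflTransGen_commMove (h _ _ hω hω') hij

/-- The projection to two non-commuting generators is constant on the commutation class, so its
first letter is determined. -/
theorem IsFullyCommutative.head_eq {w : W} (h : cs.IsFullyCommutative w) {i j : B}
    {ω ω' : List B} (hω : cs.IsReducedExpr w (i :: ω)) (hω' : cs.IsReducedExpr w (j :: ω'))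
    (hij : M i j ≠ 2) : i = j := by
  classical
  have := h.filter_eq hω hω' hij
  simp at this
  exact this.1

theorem isLeftWeakStarReducible_inv {w : W} {i j : B} (h : cs.IsLeftWeakStarReducible w⁻¹ i j) :
    cs.IsRightWeakStarReducible w i j := by
  obtain ⟨h1, ⟨h2, h3, h4⟩, h5⟩ := h
  refine ⟨by simpa using h1.inv, ⟨by rwa [isLeftDescent_inv_iff] at h2, ?_, h4⟩, fun h => h5 ?_⟩
  · have : cs.simple i * w⁻¹ = (w * cs.simple i)⁻¹ := by simp
    rwa [this, isLeftDescent_inv_iff] at h3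
  · simpa using h.inv

theorem isRightWeakStarReducible_inv {w : W} {i j : B} (h : cs.IsRightWeakStarReducible w⁻¹ i j) :
    cs.IsLeftWeakStarReducible w i j := by
  obtain ⟨h1, ⟨h2, h3, h4⟩, h5⟩ := h
  refine ⟨by simpa using h1.inv, ⟨by rwa [isRightDescent_inv_iff] at h2, ?_, h4⟩, fun h => h5 ?_⟩
  · have : w⁻¹ * cs.simple i = (cs.simple i * w)⁻¹ := by simp
    rwa [this, isRightDescent_inv_iff] at h3
  · simpa using h.inv

theorem IsNonCancellable.inv {w : W} (h : cs.IsNonCancellable w) : cs.IsNonCancellable w⁻¹ := by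
  refine ⟨h.1.inv, ?_⟩
  rintro ⟨i, j, h1 | h1⟩
  · exact h.2 ⟨i, j, .inr (isLeftWeakStarReducible_inv h1)⟩
  · exact h.2 ⟨i, j, .inl (isRightWeakStarReducible_inv h1)⟩

/-- Full commutativity persists because `w` would otherwise be left weak star reducible by `i` with
respect to `j`. The length goes up because a reduced word of `w` starting with `j` would contradict
`head_eq`. -/
theorem IsNonCancellable.isReducedExpr_cons {w : W} (h : cs.IsNonCancellable w) {i j : B}
    {ω : List B} (hω : cs.IsReducedExpr w (i :: j :: ω)) (hij : 3 ≤ M i j) :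
    cs.IsFullyCommutative (cs.simple j * w) ∧
      cs.IsReducedExpr (cs.simple j * w) (j :: i :: j :: ω) := by
  constructor
  · by_contra hn
    exact h.2 ⟨i, j, .inl ⟨h.1, ⟨hω.isLeftDescent, hω.tail.isLeftDescent, .inl hij⟩, hn⟩⟩
  · apply hω.cons
    intro hd
    obtain ⟨ω', hω'⟩ := hd.exists_isReducedExpr
    obtain rfl := h.1.head_eq hω hω' (by lia)
    simp at hij

theorem IsNonCancellable.not_isReducedExpr_of_eq_three {w : W} (h : cs.IsNonCancellable w)
    {i j : B} {ω : List B} (hij : M i j = 3) : ¬ cs.IsReducedExpr w (i :: j :: ω) := by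
  intro hω
  obtain ⟨h1, h2⟩ := h.isReducedExpr_cons hω (by lia)
  have h3 : cs.IsReducedExpr (cs.simple j * w) (i :: j :: i :: ω) :=
    h2.of_wordProd_eq (by
      simp only [wordProd_cons, ← mul_assoc]
      rw [cs.simple_braid hij]) rfl
  obtain rfl := h1.head_eq h3 h2 (by lia)
  simp at hij

theorem IsNonCancellable.not_isReducedExpr_of_eq_four {w : W} (h : cs.IsNonCancellable w)
    {i j : B} {ω : List B} (hij : M i j = 4) : ¬ cs.IsReducedExpr w (i :: j :: i :: ω) := by
  intro hω
  obtain ⟨h1, h2⟩ := h.isReducedExpr_cons hω (by lia)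
  have h3 : cs.IsReducedExpr (cs.simple j * w) (i :: j :: i :: j :: ω) :=
    h2.of_wordProd_eq (by
      simp only [wordProd_cons, ← mul_assoc]
      rw [cs.simple_long_braid hij]) rfl
  obtain rfl := h1.head_eq h3 h2 (by lia)
  simp at hij

theorem IsReducedExpr.no_square {w : W} {u a v : List B} {i : B}
    (hω : cs.IsReducedExpr w (u ++ i :: (a ++ i :: v))) (ha : ∀ x ∈ a, M x i = 2) : False := by
  have h1 : cs.wordProd (u ++ i :: (a ++ i :: v)) = cs.wordProd (u ++ (a ++ v)) := by
    rw [wordProd_append, wordProd_cons, cs.wordProd_eq_of_reflTransGen_commMove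
      (reflTransGen_commMove_middle ha), wordProd_cons, simple_mul_simple_cancel_left,
      ← wordProd_append]
  have h2 := cs.length_wordProd_le (u ++ (a ++ v))
  rw [← h1, hω.1.eq] at h2
  simp at h2

theorem IsFullyCommutative.no_braid {w : W} (h : cs.IsFullyCommutative w) {u a b v : List B}
    {i j : B} (hω : cs.IsReducedExpr w (u ++ i :: (a ++ j :: (b ++ i :: v)))) (hij : M i j = 3)
    (ha : ∀ x ∈ a, M x i = 2) (hb : ∀ x ∈ b, M x i = 2) : False := by
  classical
  have ha' : ∀ b, cs.wordProd (i :: (a ++ b)) = cs.wordProd (a ++ i :: b) := fun b =>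
    (cs.wordProd_eq_of_reflTransGen_commMove (reflTransGen_commMove_middle ha)).symm
  have h1 : cs.wordProd (u ++ (a ++ j :: i :: j :: (b ++ v))) =
      cs.wordProd (u ++ i :: (a ++ j :: (b ++ i :: v))) := by
    rw [wordProd_append, wordProd_append _ u, ha', wordProd_append _ a, wordProd_append _ a,
      wordProd_cons _ i, wordProd_cons _ j (b ++ i :: v),
      cs.wordProd_eq_of_reflTransGen_commMove (reflTransGen_commMove_middle hb)]
    have e := congrArg (· * cs.wordProd (b ++ v)) (cs.simple_braid hij)
    simp only [mul_assoc] at e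
    simp only [wordProd_cons, e]
  have h2 := h _ _ hω (hω.of_wordProd_eq h1 (by simp; lia))
  -- Commutation moves preserve the number of letters `i`, while the braid relation turns two of
  -- them into one.
  have h3 := (perm_of_reflTransGen_commMove h2).count_eq i
  have hne : i ≠ j := by rintro rfl; simp at hij
  simp [List.count_append, hne.symm] at h3
  lia

theorem IsFullyCommutative.no_long_braid {w : W} (h : cs.IsFullyCommutative w)
    {u a b c v : List B} {i j : B}
    (hω : cs.IsReducedExpr w (u ++ i :: (a ++ j :: (b ++ i :: (c ++ j :: v))))) (hij : M i j = 4)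
    (ha : ∀ x ∈ a, M x i = 2) (hb : ∀ x ∈ b, M x i = 2) (hb' : ∀ x ∈ b, M x j = 2)
    (hc : ∀ x ∈ c, M x j = 2) : False := by
  classical
  have mid : ∀ {s : List B} {k : B}, (∀ x ∈ s, M x k = 2) → ∀ t,
      cs.wordProd (s ++ k :: t) = cs.wordProd (k :: (s ++ t)) := fun hs t =>
    cs.wordProd_eq_of_reflTransGen_commMove (reflTransGen_commMove_middle hs)
  have e1 : cs.wordProd (u ++ i :: (a ++ j :: (b ++ i :: (c ++ j :: v)))) =
      cs.wordProd (u ++ a ++ i :: j :: i :: j :: (b ++ (c ++ v))) := by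
    rw [List.append_assoc, wordProd_append, wordProd_append _ u]
    congr 1
    rw [← mid ha, wordProd_append, wordProd_append _ a]
    congr 1
    rw [wordProd_cons, wordProd_cons, wordProd_cons, wordProd_cons]
    congr 2
    rw [mid hb, wordProd_cons, wordProd_append, mid hc, ← wordProd_append, mid hb', ← wordProd_cons]
  have e2 : cs.wordProd (u ++ a ++ j :: i :: j :: i :: (b ++ (c ++ v))) =
      cs.wordProd (u ++ a ++ i :: j :: i :: j :: (b ++ (c ++ v))) := by
    rw [wordProd_append, wordProd_append _ (u ++ a)]
    congr 1
    simp only [wordProd_cons, ← mul_assoc]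
    rw [cs.simple_long_braid hij]
  have h1 := hω.of_wordProd_eq e1.symm (by simp; lia)
  have h2 := h1.of_wordProd_eq e2 (by simp)
  -- Letter counts do not separate i j i j from j i j i, but the order of the letters `i` and `j`
  -- does.
  have h3 := h.filter_eq h1 h2 (i := i) (j := j) (by lia)
  simp [List.filter_append] at h3
  obtain ⟨rfl, -⟩ := h3
  simp at hij

end CoxeterSystem

/-! ### Path labellings, and the passage from reduced expressions to words of labels. -/

/-- `f` labels the generators by vertices of the half-infinite path whose Coxeter matrix is
`pathEntry`. -/
structure CoxeterMatrix.IsPathLabelling {B : Type*} (M : CoxeterMatrix B) (f : B → ℕ) : Prop where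
  pos : ∀ i, 1 ≤ f i
  injective : Function.Injective f
  entry : ∀ i j, M i j = pathEntry (f i) (f j)

namespace CoxeterMatrix.IsPathLabelling

variable {B : Type*} {M : CoxeterMatrix B} {f : B → ℕ}

theorem eq_two (hf : M.IsPathLabelling f) {i j : B} (h : f i + 1 < f j ∨ f j + 1 < f i) :
    M i j = 2 := by
  rw [hf.entry, pathEntry]
  grind

theorem eq_three (hf : M.IsPathLabelling f) {i j : B} (hi : 2 ≤ f i) (hj : 2 ≤ f j)
    (h : f i + 1 = f j ∨ f j + 1 = f i) : M i j = 3 := by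
  rw [hf.entry, pathEntry]
  grind

theorem eq_four (hf : M.IsPathLabelling f) {i j : B} (h : f i = 1 ∧ f j = 2 ∨ f i = 2 ∧ f j = 1) :
    M i j = 4 := by
  rw [hf.entry, pathEntry]
  grind

theorem eq_two_of_apart (hf : M.IsPathLabelling f) {a : List B} {i : B}
    (h : Apart (f i) (a.map f)) : ∀ x ∈ a, M x i = 2 :=
  fun x hx => hf.eq_two (h (f x) (List.mem_map_of_mem hx))

theorem isLiftable (hf : M.IsPathLabelling f) : M.IsLiftable fun i => signedSwap (f i) :=
  fun i j => by rw [hf.entry]; exact signedSwap_mul_pow_pathEntry (hf.pos i) (hf.pos j)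

end CoxeterMatrix.IsPathLabelling

namespace CoxeterSystem

variable {B : Type*} {M : CoxeterMatrix B} {W : Type*} [Group W] {cs : CoxeterSystem M W}
  {f : B → ℕ}

theorem simple_injective_of_isPathLabelling (hf : M.IsPathLabelling f) {i j : B}
    (h : cs.simple i = cs.simple j) : i = j := by
  have := congrArg (cs.lift ⟨_, hf.isLiftable⟩) h
  rw [lift_apply_simple _ hf.isLiftable, lift_apply_simple _ hf.isLiftable] at this
  exact hf.injective (signedSwap_injective (hf.pos i) (hf.pos j) this)

theorem simple_mul_simple_mul_simple_ne (hf : M.IsPathLabelling f) {i j : B}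
    (hij : f i = 1 ∧ f j = 2 ∨ f i = 2 ∧ f j = 1) (k : B) :
    cs.simple i * cs.simple j * cs.simple i ≠ cs.simple k := by
  intro h
  have := congrArg (cs.lift ⟨_, hf.isLiftable⟩) h
  simp only [map_mul, lift_apply_simple _ hf.isLiftable] at this
  rcases hij with ⟨h1, h2⟩ | ⟨h1, h2⟩ <;> rw [h1, h2] at this
  · exact signedSwap_one_two_one_ne (hf.pos k) this
  · exact signedSwap_two_one_two_ne (hf.pos k) this

theorem IsFullyCommutative.braidFree (hf : M.IsPathLabelling f) {w : W}
    (h : cs.IsFullyCommutative w) {ω : List B} (hω : cs.IsReducedExpr w ω) :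
    BraidFree (ω.map f) where
  pos := by
    intro h0
    obtain ⟨i, -, hi⟩ := List.mem_map.mp h0
    have := hf.pos i
    lia
  no_square u a v k hl ha := by
    obtain ⟨u, ω1, rfl, rfl, hm1⟩ := List.map_eq_append_iff.mp hl
    obtain ⟨i, ω1, rfl, rfl, hm2⟩ := List.map_eq_cons_iff.mp hm1
    obtain ⟨a, ω1, rfl, rfl, hm3⟩ := List.map_eq_append_iff.mp hm2
    obtain ⟨i', v, rfl, hi, rfl⟩ := List.map_eq_cons_iff.mp hm3
    obtain rfl := hf.injective hi
    exact hω.no_square (hf.eq_two_of_apart ha)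
  no_braid u a b v j k hl hj hk hjk ha hb := by
    obtain ⟨u, ω1, rfl, rfl, hm1⟩ := List.map_eq_append_iff.mp hl
    obtain ⟨i, ω1, rfl, rfl, hm2⟩ := List.map_eq_cons_iff.mp hm1
    obtain ⟨a, ω1, rfl, rfl, hm3⟩ := List.map_eq_append_iff.mp hm2
    obtain ⟨j, ω1, rfl, rfl, hm4⟩ := List.map_eq_cons_iff.mp hm3
    obtain ⟨b, ω1, rfl, rfl, hm5⟩ := List.map_eq_append_iff.mp hm4
    obtain ⟨i', v, rfl, hi, rfl⟩ := List.map_eq_cons_iff.mp hm5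
    obtain rfl := hf.injective hi
    exact h.no_braid hω (hf.eq_three hk hj (by lia)) (hf.eq_two_of_apart ha) (hf.eq_two_of_apart hb)
  no_long_braid u a b c v j k hl hjk ha hb hb' hc := by
    obtain ⟨u, ω1, rfl, rfl, hm1⟩ := List.map_eq_append_iff.mp hl
    obtain ⟨j, ω1, rfl, rfl, hm2⟩ := List.map_eq_cons_iff.mp hm1
    obtain ⟨a, ω1, rfl, rfl, hm3⟩ := List.map_eq_append_iff.mp hm2
    obtain ⟨k, ω1, rfl, rfl, hm4⟩ := List.map_eq_cons_iff.mp hm3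
    obtain ⟨b, ω1, rfl, rfl, hm5⟩ := List.map_eq_append_iff.mp hm4
    obtain ⟨j', ω1, rfl, hj, hm6⟩ := List.map_eq_cons_iff.mp hm5
    obtain ⟨c, ω1, rfl, rfl, hm7⟩ := List.map_eq_append_iff.mp hm6
    obtain ⟨k', v, rfl, hk, rfl⟩ := List.map_eq_cons_iff.mp hm7
    obtain rfl := hf.injective hj
    obtain rfl := hf.injective hk
    exact h.no_long_braid hω (hf.eq_four hjk) (hf.eq_two_of_apart ha)
      (hf.eq_two_of_apart hb) (hf.eq_two_of_apart hb') (hf.eq_two_of_apart hc)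

theorem IsNonCancellable.leftIrreducible (hf : M.IsPathLabelling f) {w : W}
    (h : cs.IsNonCancellable w) {ω : List B} (hω : cs.IsReducedExpr w ω) :
    LeftIrreducible (ω.map f) where
  no_edge u a v j k hl hj hk hjk hu hu' ha := by
    obtain ⟨u, ω1, rfl, rfl, hm1⟩ := List.map_eq_append_iff.mp hl
    obtain ⟨i, ω1, rfl, rfl, hm2⟩ := List.map_eq_cons_iff.mp hm1
    obtain ⟨a, ω1, rfl, rfl, hm3⟩ := List.map_eq_append_iff.mp hm2
    obtain ⟨j, v, rfl, rfl, rfl⟩ := List.map_eq_cons_iff.mp hm3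
    have h1 := hω.of_commMove (reflTransGen_commMove_middle (hf.eq_two_of_apart hu))
    rw [← List.append_assoc] at h1
    have h2 := h1.of_commMove (reflTransGen_commMove_cons (reflTransGen_commMove_middle
      (hf.eq_two_of_apart (i := j) (by simpa using hu'.append ha))) i)
    exact h.not_isReducedExpr_of_eq_three (hf.eq_three hk hj (by lia)) h2
  no_double_edge u a b v j k hl hjk hu hu' ha ha' hb := by
    obtain ⟨u, ω1, rfl, rfl, hm1⟩ := List.map_eq_append_iff.mp hl
    obtain ⟨j, ω1, rfl, rfl, hm2⟩ := List.map_eq_cons_iff.mp hm1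
    obtain ⟨a, ω1, rfl, rfl, hm3⟩ := List.map_eq_append_iff.mp hm2
    obtain ⟨k, ω1, rfl, rfl, hm4⟩ := List.map_eq_cons_iff.mp hm3
    obtain ⟨b, ω1, rfl, rfl, hm5⟩ := List.map_eq_append_iff.mp hm4
    obtain ⟨j', v, rfl, hj, rfl⟩ := List.map_eq_cons_iff.mp hm5
    obtain rfl := hf.injective hj
    have h1 := hω.of_commMove (reflTransGen_commMove_middle (hf.eq_two_of_apart hu))
    rw [← List.append_assoc] at h1
    have h2 := h1.of_commMove (reflTransGen_commMove_cons (reflTransGen_commMove_middle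
      (hf.eq_two_of_apart (i := k) (by simpa using hu'.append ha'))) j')
    rw [← List.append_assoc] at h2
    have h3 := h2.of_commMove (reflTransGen_commMove_cons (reflTransGen_commMove_cons
      (reflTransGen_commMove_middle
        (hf.eq_two_of_apart (i := j') (by simpa using (hu.append ha).append hb))) k) j')
    exact h.not_isReducedExpr_of_eq_four (hf.eq_four hjk) h3

/-- The elements that the classification describes: `w = s_p s_q u` with `u` a product of commuting
generators whose support avoids the labels `1`, `2` and `3`. -/
def IsShortTimesCommuting (cs : CoxeterSystem M W) (f : B → ℕ) (p q : B) (w : W) : Prop :=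
  ∃ u : W, cs.IsProdCommGenerators u ∧ (∀ i ∈ cs.support u, f i ≠ 1 ∧ f i ≠ 2 ∧ f i ≠ 3) ∧
    w = cs.simple p * cs.simple q * u

/-! ### Non-cancellable elements have one of the listed forms. -/

section Forward

theorem pairwise_of_nodup_of_not_adjacent (hf : M.IsPathLabelling f) {ω τ : List B}
    (hτ : τ.Sublist ω) (hn : (ω.map f).Nodup)
    (hadj : ∀ m, 1 ≤ m → m + 2 ∈ ω.map f → m + 1 ∉ ω.map f)
    (h12 : ¬ (1 ∈ τ.map f ∧ 2 ∈ τ.map f)) : τ.Pairwise (fun i j => M i j = 2) := by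
  rw [List.pairwise_iff_forall_sublist]
  intro x y hxy
  have hne : f x ≠ f y := by
    have := ((hxy.trans hτ).map f).nodup hn
    simpa using this
  have hx : f x ∈ τ.map f := List.mem_map_of_mem (hxy.subset (by simp))
  have hy : f y ∈ τ.map f := List.mem_map_of_mem (hxy.subset (by simp))
  have hsub := (hτ.map f).subset
  have key : ∀ a b, a ∈ τ.map f → b ∈ τ.map f → 1 ≤ a → a + 1 ≠ b := by
    rintro a _ ha hb h1 rfl
    obtain _ | _ | a := a
    · lia
    · exact h12 ⟨ha, hb⟩
    · exact hadj (a + 1) (by lia) (hsub hb) (hsub ha)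
  have h1 := key _ _ hx hy (hf.pos x)
  have h2 := key _ _ hy hx (hf.pos y)
  exact hf.eq_two (by lia)

/-- Label 2 occurs, so label 3 does not, and `p` and `q` commute with all other letters and can be
moved to the front. -/
theorem isShortTimesCommuting_of_isReducedExpr (hf : M.IsPathLabelling f) {w : W}
    (h : cs.IsFullyCommutative w) {u a v : List B} {p q : B}
    (hω : cs.IsReducedExpr w (u ++ p :: (a ++ q :: v)))
    (hpq : f p = 1 ∧ f q = 2 ∨ f p = 2 ∧ f q = 1)
    (hn : ((u ++ p :: (a ++ q :: v)).map f).Nodup)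
    (hadj : ∀ m, 1 ≤ m → m + 2 ∈ (u ++ p :: (a ++ q :: v)).map f →
      m + 1 ∉ (u ++ p :: (a ++ q :: v)).map f) :
    cs.IsShortTimesCommuting f p q w := by
  have h2 : 2 ∈ (u ++ p :: (a ++ q :: v)).map f := by
    rcases hpq with ⟨h1, h2⟩ | ⟨h1, h2⟩ <;> simp [h1, h2]
  have h3 : ∀ x ∈ u ++ p :: (a ++ q :: v), f x ≠ 3 := fun x hx h3 =>
    hadj 1 le_rfl (List.mem_map.mpr ⟨x, hx, h3⟩) h2
  have hn' : (u ++ p :: (a ++ q :: v)).Nodup := hn.of_map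
  have label : ∀ x ∈ u ++ p :: (a ++ q :: v), x ≠ p → x ≠ q → f x ≠ 1 ∧ f x ≠ 2 ∧ f x ≠ 3 := by
    intro x hx hxp hxq
    have e1 : f x ≠ f p := fun e => hxp (hf.injective e)
    have e2 : f x ≠ f q := fun e => hxq (hf.injective e)
    have e3 := h3 x hx
    lia
  have label' : ∀ x ∈ u ++ (a ++ v), f x ≠ 1 ∧ f x ≠ 2 ∧ f x ≠ 3 := by
    intro x hx
    apply label x
    · simp only [List.mem_append, List.mem_cons] at hx ⊢
      tauto
    · rintro rfl
      grind
    · rintro rfl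
      grind
  have comm : ∀ x ∈ u ++ (a ++ v), M x p = 2 ∧ M x q = 2 := by
    intro x hx
    have h1 := label' x hx
    have h2 := hf.pos x
    exact ⟨hf.eq_two (by lia), hf.eq_two (by lia)⟩
  have hc := hω.of_commMove (reflTransGen_commMove_middle
    fun x hx => (comm x (by simp [hx])).1)
  rw [← List.append_assoc] at hc
  replace hc := hc.of_commMove (reflTransGen_commMove_cons (reflTransGen_commMove_middle
    fun x hx => (comm x (by simp at hx ⊢; tauto)).2) p)
  rw [List.append_assoc] at hc
  refine ⟨cs.wordProd (u ++ (a ++ v)), ⟨_, ?_, rfl⟩, ?_, ?_⟩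
  · refine pairwise_of_nodup_of_not_adjacent hf ?_ hn hadj ?_
    · exact List.Sublist.append_left (((List.sublist_cons_self q v).append_left a).cons p) u
    · rintro ⟨h1, -⟩
      obtain ⟨x, hx, h1⟩ := List.mem_map.mp h1
      exact (label' x hx).1 h1
  · rintro x ⟨ω', hω', hx⟩
    -- The support ranges over every reduced expression of the remaining factor. Prefixing `p q`
    -- gives a reduced expression of `w`, hence a permutation of the original word without
    -- repetitions, so neither `p` nor `q` recurs in `ω'`.
    have hlen : ω'.length = (u ++ (a ++ v)).length := by
      rw [← hω'.1.eq, hω'.2, hc.tail.tail.1.eq]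
    have hc' : cs.IsReducedExpr w (p :: q :: ω') :=
      hc.of_wordProd_eq (by simp only [wordProd_cons, hω'.2]) (by simp [hlen])
    have hperm := perm_of_reflTransGen_commMove (h _ _ hc' hω)
    have hnd := hperm.nodup_iff.mpr hn'
    apply label x (hperm.subset (by simp [hx]))
    · rintro rfl
      exact (List.nodup_cons.mp hnd).1 (by simp [hx])
    · rintro rfl
      exact (List.nodup_cons.mp (List.nodup_cons.mp hnd).2).1 hx
  · rw [← hc.2, wordProd_cons, wordProd_cons, mul_assoc]

theorem IsNonCancellable.classification (hf : M.IsPathLabelling f) {p q : B} (hp : f p = 1)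
    (hq : f q = 2) {w : W} (h : cs.IsNonCancellable w) :
    cs.IsProdCommGenerators w ∨ cs.IsShortTimesCommuting f p q w ∨
      cs.IsShortTimesCommuting f q p w := by
  obtain ⟨ω, hω⟩ := cs.exists_isReducedExpr w
  have hB := h.1.braidFree hf hω
  have hL := h.leftIrreducible hf hω
  have hR := h.inv.leftIrreducible hf hω.reverse
  rw [List.map_reverse] at hR
  have hn := hB.nodup hL hR
  have hadj : ∀ m, 1 ≤ m → m + 2 ∈ ω.map f → m + 1 ∉ ω.map f := fun m hm => hB.not_adjacent hL hR hm
  by_cases h12 : 1 ∈ ω.map f ∧ 2 ∈ ω.map f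
  · right
    have hpω : p ∈ ω := by
      obtain ⟨x, hx, h1⟩ := List.mem_map.mp h12.1
      rwa [hf.injective (hp.trans h1.symm)]
    have hqω : q ∈ ω := by
      obtain ⟨x, hx, h1⟩ := List.mem_map.mp h12.2
      rwa [hf.injective (hq.trans h1.symm)]
    have hpq : q ≠ p := by
      rintro rfl
      lia
    obtain ⟨u, v, rfl⟩ := List.append_of_mem hpω
    simp only [List.mem_append, List.mem_cons, hpq, false_or] at hqω
    rcases hqω with hqω | hqω
    · obtain ⟨u, a, rfl⟩ := List.append_of_mem hqω
      rw [List.append_assoc, List.cons_append] at hω hn hadj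
      exact .inr (isShortTimesCommuting_of_isReducedExpr hf h.1 hω (by lia) hn hadj)
    · obtain ⟨a, v, rfl⟩ := List.append_of_mem hqω
      exact .inl (isShortTimesCommuting_of_isReducedExpr hf h.1 hω (by lia) hn hadj)
  · exact .inl ⟨ω, pairwise_of_nodup_of_not_adjacent hf (List.Sublist.refl ω) hn hadj h12, hω.2⟩

end Forward

end CoxeterSystem

/-! ### The listed elements are non-cancellable. -/

namespace CoxeterSystem

variable {B : Type*} {M : CoxeterMatrix B} {W : Type*} [Group W] {cs : CoxeterSystem M W}
  {f : B → ℕ}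

theorem wordProd_mul_simple_mul_inv_of_commute {a : List B} {k : B} (h : ∀ x ∈ a, M x k = 2) :
    cs.wordProd a * cs.simple k * (cs.wordProd a)⁻¹ = cs.simple k := by
  have h1 := cs.wordProd_eq_of_reflTransGen_commMove (reflTransGen_commMove_middle (b := []) h)
  rw [wordProd_append, wordProd_singleton, wordProd_cons, List.append_nil] at h1
  rw [h1, mul_inv_cancel_right]

/-- `ω` is an alternating word of length at most `3` in the two generators labelled `1` and `2`. -/
def IsShortAlternating (f : B → ℕ) (ω : List B) : Prop :=
  ω = [] ∨ (∃ i, ω = [i]) ∨ ∃ i j, (f i = 1 ∧ f j = 2 ∨ f i = 2 ∧ f j = 1) ∧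
    (ω = [i, j] ∨ ω = [i, j, i])

theorem IsShortAlternating.tail {i : B} {ω : List B} (h : IsShortAlternating f (i :: ω)) :
    IsShortAlternating f ω := by
  rcases h with h | ⟨j, h⟩ | ⟨j, k, hjk, h | h⟩
  · simp at h
  · obtain ⟨rfl, rfl⟩ := List.cons_eq_cons.mp h
    exact .inl rfl
  · obtain ⟨rfl, rfl⟩ := List.cons_eq_cons.mp h
    exact .inr (.inl ⟨k, rfl⟩)
  · obtain ⟨rfl, rfl⟩ := List.cons_eq_cons.mp h
    exact .inr (.inr ⟨k, i, by lia, .inl rfl⟩)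

theorem IsShortAlternating.ne {i j : B} {ω : List B} (h : IsShortAlternating f (i :: j :: ω)) :
    i ≠ j := by
  rcases h with h | ⟨k, h⟩ | ⟨k, l, hkl, h | h⟩
  · simp at h
  · simp at h
  all_goals
    simp at h
    rintro rfl
    grind

/-- A word `X ++ υ` where `X` is a short alternating word and `υ` is a word of pairwise commuting
generators which also commute with the letters of `X`. -/
structure IsSplitWord (M : CoxeterMatrix B) (f : B → ℕ) (X υ : List B) : Prop where
  short : IsShortAlternating f X
  pairwise : υ.Pairwise (fun i j => M i j = 2)
  commute : ∀ x ∈ X, ∀ y ∈ υ, M x y = 2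

namespace IsSplitWord

variable {X υ : List B}

theorem tail {i : B} (h : IsSplitWord M f (i :: X) υ) : IsSplitWord M f X υ :=
  ⟨h.short.tail, h.pairwise, fun x hx => h.commute x (by simp [hx])⟩

theorem erase {i : B} {υ₁ υ₂ : List B} (h : IsSplitWord M f X (υ₁ ++ i :: υ₂)) :
    IsSplitWord M f X (υ₁ ++ υ₂) :=
  ⟨h.short, h.pairwise.sublist ((List.sublist_cons_self i υ₂).append_left υ₁),
    fun x hx y hy => h.commute x hx y (by simp at hy ⊢; tauto)⟩

theorem commute_middle {i : B} {υ₁ υ₂ : List B} (h : IsSplitWord M f X (υ₁ ++ i :: υ₂)) :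
    ∀ x ∈ X ++ υ₁, M x i = 2 := by
  intro x hx
  rcases List.mem_append.mp hx with hx | hx
  · exact h.commute x hx i (by simp)
  · exact (List.pairwise_append.mp h.pairwise).2.2 x hx i (by simp)

theorem move_middle {i : B} {υ₁ υ₂ : List B} (h : IsSplitWord M f X (υ₁ ++ i :: υ₂)) :
    Relation.ReflTransGen (CommMove M) (X ++ (υ₁ ++ i :: υ₂)) (i :: (X ++ (υ₁ ++ υ₂))) := by
  have := reflTransGen_commMove_middle (b := υ₂) h.commute_middle
  simpa using this

theorem commute_of_mem_erase {i j : B} {υ₁ υ₂ : List B} (h : IsSplitWord M f X (υ₁ ++ i :: υ₂))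
    (hj : j ∈ υ₁ ++ υ₂) : M i j = 2 := by
  rcases List.mem_append.mp hj with hj | hj
  · rw [M.symmetric]
    exact h.commute_middle j (by simp [hj])
  · exact (List.pairwise_cons.mp (List.pairwise_append.mp h.pairwise).2.1).1 j hj

theorem reverse (h : IsSplitWord M f X υ) (hX : X.length ≤ 2) :
    IsSplitWord M f X.reverse υ.reverse where
  short := by
    rcases h.short with rfl | ⟨i, rfl⟩ | ⟨i, j, hij, rfl | rfl⟩
    · exact .inl rfl
    · exact .inr (.inl ⟨i, rfl⟩)
    · exact .inr (.inr ⟨j, i, by lia, .inl rfl⟩)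
    · simp at hX
  pairwise := by
    rw [List.pairwise_reverse]
    exact h.pairwise.imp fun hxy => by rwa [M.symmetric]
  commute x hx y hy := h.commute x (by simpa using hx) y (by simpa using hy)

theorem wordProd_comm (h : IsSplitWord M f X υ) :
    cs.wordProd (X ++ υ) = cs.wordProd (υ ++ X) := by
  induction X with
  | nil => simp
  | cons i X ih =>
    rw [List.cons_append, wordProd_cons, ih h.tail, ← wordProd_cons]
    refine (cs.wordProd_eq_of_reflTransGen_commMove (reflTransGen_commMove_middle ?_)).symm
    intro x hx
    rw [M.symmetric]
    exact h.commute i (by simp) x hx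

/-- By exchange, `s_k` is a letter conjugated by the part of the word before it. A letter of `υ`, or
the first letter of `X`, is unchanged by this conjugation; the second or third letter of `X` becomes
an alternating product of length 3, which is not a generator. -/
theorem eq_of_isLeftDescent (hf : M.IsPathLabelling f) (h : IsSplitWord M f X υ) {k : B}
    (hk : cs.IsLeftDescent (cs.wordProd (X ++ υ)) k) : k ∈ υ ∨ ∃ Y, X = k :: Y := by
  obtain ⟨a, l, b, hl, hkl⟩ := cs.exists_eq_conj_of_isLeftDescent hk
  rcases List.append_eq_append_iff.mp hl with ⟨c, rfl, rfl⟩ | ⟨c, hX, hc⟩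
  · left
    rw [wordProd_mul_simple_mul_inv_of_commute h.commute_middle] at hkl
    simp [simple_injective_of_isPathLabelling hf hkl]
  · obtain _ | ⟨l', c⟩ := c
    · left
      simp only [List.nil_append] at hc
      simp only [List.append_nil] at hX
      subst hX hc
      have h' : IsSplitWord M f X ([] ++ l :: b) := h
      have := h'.commute_middle
      rw [List.append_nil] at this
      rw [wordProd_mul_simple_mul_inv_of_commute this] at hkl
      rw [simple_injective_of_isPathLabelling hf hkl]
      simp
    · right
      obtain ⟨rfl, rfl⟩ := List.cons_eq_cons.mp hc
      subst hX
      obtain _ | ⟨i, a⟩ := a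
      · refine ⟨c, ?_⟩
        rw [wordProd_nil] at hkl
        have hkl' : cs.simple k = cs.simple l := by simpa using hkl
        rw [simple_injective_of_isPathLabelling hf hkl']
        rfl
      · exfalso
        rcases h.short with hX | ⟨j, hX⟩ | ⟨j, m, hjm, hX | hX⟩
        · simp at hX
        · simp at hX
        · obtain _ | ⟨i', a⟩ := a
          · simp at hX
            obtain ⟨rfl, rfl, -⟩ := hX
            refine simple_mul_simple_mul_simple_ne (cs := cs) hf hjm k ?_
            rw [hkl]
            simp
          · simp at hX
        · obtain _ | ⟨i', a⟩ := a
          · simp at hX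
            obtain ⟨rfl, rfl, -⟩ := hX
            refine simple_mul_simple_mul_simple_ne (cs := cs) hf hjm k ?_
            rw [hkl]
            simp
          · obtain _ | ⟨i'', a⟩ := a
            · simp at hX
              obtain ⟨rfl, rfl, rfl, -⟩ := hX
              refine simple_mul_simple_mul_simple_ne (cs := cs) hf (i := i') (j := l) (by lia) k ?_
              -- Conjugating the third letter gives i j i j i, which the long braid relation
              -- shortens to j i j.
              have := cs.simple_long_braid (hf.eq_four hjm)
              rw [hkl, wordProd_cons, wordProd_singleton, mul_inv_rev, inv_simple, inv_simple,
                ← mul_assoc, this]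
              simp
            · simp at hX

theorem isReduced (hf : M.IsPathLabelling f) (h : IsSplitWord M f X υ) : cs.IsReduced (X ++ υ) := by
  have step : ∀ k ω, cs.IsReduced ω → ¬ cs.IsLeftDescent (cs.wordProd ω) k →
      cs.IsReduced (k :: ω) := fun k ω h1 h2 => (IsReducedExpr.cons ⟨h1, rfl⟩ h2).1
  induction X with
  | nil =>
    induction υ with
    | nil => simp [IsReduced]
    | cons x υ ih =>
      have h' : IsSplitWord M f [] υ := h.erase (υ₁ := [])
      refine step _ _ (ih h') fun hd => ?_
      rcases h'.eq_of_isLeftDescent hf hd with hx | ⟨Y, hY⟩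
      · have := h.commute_of_mem_erase (υ₁ := []) hx
        simp at this
      · simp at hY
  | cons k X ih =>
    refine step _ _ (ih h.tail) fun hd => ?_
    rcases h.tail.eq_of_isLeftDescent hf hd with hx | ⟨Y, rfl⟩
    · have := h.commute k (by simp) k hx
      simp at this
    · exact h.short.ne rfl

theorem isReducedExpr (hf : M.IsPathLabelling f) (h : IsSplitWord M f X υ) :
    cs.IsReducedExpr (cs.wordProd (X ++ υ)) (X ++ υ) :=
  ⟨h.isReduced hf, rfl⟩

/-- The first letter of `τ` is a left descent, so it is the head of `X` or lies in `υ`. In either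
case it can be brought to the front of `X ++ υ`, and cancelling it leaves a shorter split word. -/
theorem reflTransGen_of_isReducedExpr (hf : M.IsPathLabelling f) (h : IsSplitWord M f X υ)
    {τ : List B} (hτ : cs.IsReducedExpr (cs.wordProd (X ++ υ)) τ) :
    Relation.ReflTransGen (CommMove M) τ (X ++ υ) := by
  induction τ generalizing X υ with
  | nil =>
    have h1 := (h.isReduced (cs := cs) hf).eq
    rw [← hτ.2, hτ.1.eq] at h1
    rw [List.length_eq_zero_iff.mp h1.symm]
  | cons k τ ih =>
    have ht := hτ.tail
    rcases h.eq_of_isLeftDescent hf hτ.isLeftDescent with hk | ⟨Y, rfl⟩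
    · obtain ⟨υ₁, υ₂, rfl⟩ := List.append_of_mem hk
      rw [cs.wordProd_eq_of_reflTransGen_commMove h.move_middle, wordProd_cons,
        simple_mul_simple_cancel_left] at ht
      exact (reflTransGen_commMove_cons (ih h.erase ht) k).trans
        (reflTransGen_commMove_symm h.move_middle)
    · rw [List.cons_append, wordProd_cons, simple_mul_simple_cancel_left] at ht
      exact reflTransGen_commMove_cons (ih h.tail ht) k

theorem isFullyCommutative (hf : M.IsPathLabelling f) (h : IsSplitWord M f X υ) :
    cs.IsFullyCommutative (cs.wordProd (X ++ υ)) := fun _ _ hω hω' =>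
  (h.reflTransGen_of_isReducedExpr hf hω).trans
    (reflTransGen_commMove_symm (h.reflTransGen_of_isReducedExpr hf hω'))

theorem not_isLeftWeakStarReducible (hf : M.IsPathLabelling f) (h : IsSplitWord M f X υ)
    (hX : X.length ≤ 2) (i j : B) :
    ¬ cs.IsLeftWeakStarReducible (cs.wordProd (X ++ υ)) i j := by
  rintro ⟨-, ⟨hi, hj, hij⟩, hn⟩
  have hij2 : M i j ≠ 2 := by lia
  rcases h.eq_of_isLeftDescent hf hi with hk | ⟨Y, rfl⟩
  · obtain ⟨υ₁, υ₂, rfl⟩ := List.append_of_mem hk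
    rw [cs.wordProd_eq_of_reflTransGen_commMove h.move_middle, wordProd_cons,
      simple_mul_simple_cancel_left] at hj
    rcases h.erase.eq_of_isLeftDescent hf hj with hk' | ⟨Y, rfl⟩
    · exact hij2 (h.commute_of_mem_erase hk')
    · exact hij2 (by rw [M.symmetric]; exact h.commute j (by simp) i (by simp))
  · rw [List.cons_append, wordProd_cons, simple_mul_simple_cancel_left] at hj
    rcases h.tail.eq_of_isLeftDescent hf hj with hk' | ⟨Z, rfl⟩
    · exact hij2 (h.commute i (by simp) j hk')
    · obtain rfl : Z = [] := by
        simpa using hX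
      -- The only star reduction available removes `i` from `X = [i, j]`. It is not a weak star
      -- reduction, because `j i j` followed by `υ` is again a split word and so fully commutative.
      have hs : IsShortAlternating f [j, i, j] := by
        rcases h.short with hX | ⟨k, hX⟩ | ⟨k, l, hkl, hX | hX⟩
        · simp at hX
        · simp at hX
        · simp at hX
          obtain ⟨rfl, rfl⟩ := hX
          exact .inr (.inr ⟨j, i, by lia, .inr rfl⟩)
        · simp at hX
      have h' : IsSplitWord M f [j, i, j] υ :=
        ⟨hs, h.pairwise, fun x hx => h.commute x (by simp at hx ⊢; tauto)⟩
      have := h'.isFullyCommutative (cs := cs) hf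
      rw [List.cons_append, wordProd_cons] at this
      exact hn this

theorem isNonCancellable (hf : M.IsPathLabelling f) (h : IsSplitWord M f X υ) (hX : X.length ≤ 2) :
    cs.IsNonCancellable (cs.wordProd (X ++ υ)) := by
  refine ⟨h.isFullyCommutative hf, ?_⟩
  rintro ⟨i, j, hr | hr⟩
  · exact h.not_isLeftWeakStarReducible hf hX i j hr
  · rw [h.wordProd_comm] at hr
    rw [← inv_inv (cs.wordProd (υ ++ X)), ← wordProd_reverse, List.reverse_append] at hr
    exact (h.reverse hX).not_isLeftWeakStarReducible hf (by simpa using hX) i j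
      (isRightWeakStarReducible_inv hr)

end IsSplitWord

theorem IsProdCommGenerators.isNonCancellable (hf : M.IsPathLabelling f) {w : W}
    (h : cs.IsProdCommGenerators w) : cs.IsNonCancellable w := by
  obtain ⟨υ, hυ, rfl⟩ := h
  exact IsSplitWord.isNonCancellable (X := []) hf ⟨.inl rfl, hυ, by simp⟩ (by simp)

theorem IsShortTimesCommuting.isNonCancellable (hf : M.IsPathLabelling f) {w : W} {p q : B}
    (hpq : f p = 1 ∧ f q = 2 ∨ f p = 2 ∧ f q = 1) (h : cs.IsShortTimesCommuting f p q w) :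
    cs.IsNonCancellable w := by
  obtain ⟨_, ⟨υ, hυ, rfl⟩, hs, rfl⟩ := h
  have h0 : IsSplitWord M f [] υ := ⟨.inl rfl, hυ, by simp⟩
  have h1 : IsSplitWord M f [p, q] υ := by
    refine ⟨.inr (.inr ⟨p, q, hpq, .inl rfl⟩), hυ, fun x hx y hy => ?_⟩
    have h2 := hs y ⟨υ, h0.isReducedExpr hf, hy⟩
    have h3 := hf.pos y
    apply hf.eq_two
    have hx' : x = p ∨ x = q := by simpa using hx
    rcases hx' with rfl | rfl <;> lia
  have := h1.isNonCancellable (cs := cs) hf (by simp)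
  rwa [List.cons_append, List.cons_append, List.nil_append, wordProd_cons, wordProd_cons,
    ← mul_assoc] at this

/-- The classification of non-cancellable elements for a path labelling. -/
theorem isNonCancellable_iff (hf : M.IsPathLabelling f) {p q : B} (hp : f p = 1) (hq : f q = 2)
    (w : W) : cs.IsNonCancellable w ↔ cs.IsProdCommGenerators w ∨
      ∃ u : W, cs.IsProdCommGenerators u ∧ (∀ i ∈ cs.support u, f i ≠ 1 ∧ f i ≠ 2 ∧ f i ≠ 3) ∧
        (w = cs.simple p * cs.simple q * u ∨ w = cs.simple q * cs.simple p * u) := by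
  constructor
  · intro h
    rcases h.classification hf hp hq with h | ⟨u, h1, h2, h3⟩ | ⟨u, h1, h2, h3⟩
    · exact .inl h
    · exact .inr ⟨u, h1, h2, .inl h3⟩
    · exact .inr ⟨u, h1, h2, .inr h3⟩
  · rintro (h | ⟨u, h1, h2, h3 | h3⟩)
    · exact h.isNonCancellable hf
    · exact IsShortTimesCommuting.isNonCancellable (p := p) (q := q) hf (by lia) ⟨u, h1, h2, h3⟩
    · exact IsShortTimesCommuting.isNonCancellable (p := q) (q := p) hf (by lia) ⟨u, h1, h2, h3⟩

end CoxeterSystem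

/-! ### The two labellings and the theorem. -/

theorem isPathLabelling_typeB (n : ℕ) :
    (typeB n).IsPathLabelling (fun i => (i : ℕ)) where
  pos i := i.2.1
  injective := Subtype.val_injective
  entry i j := by
    have h1 := i.2
    have h2 := j.2
    simp only [Set.mem_Icc] at h1 h2
    change affineCEntry n i j = pathEntry i j
    unfold affineCEntry pathEntry
    grind

/-- The path is read from its other end, so that `s_{n+1}` and `s_n` get the labels 1 and 2; the
subtraction never truncates because indices are at most `n + 1`. -/
theorem isPathLabelling_typeB' (n : ℕ) :
    (typeB' n).IsPathLabelling (fun i => n + 2 - (i : ℕ)) where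
  pos i := by
    have := i.2.2
    lia
  injective i j h := by
    have h1 := i.2.2
    have h2 := j.2.2
    exact Subtype.ext (by simp only at h; lia)
  entry i j := by
    have h1 := i.2
    have h2 := j.2
    simp only [Set.mem_Icc] at h1 h2
    change affineCEntry n i j = pathEntry (n + 2 - i) (n + 2 - j)
    unfold affineCEntry pathEntry
    grind

theorem theorem4p4 (n : ℕ) (hn : 2 ≤ n)
    {W : Type*} [Group W] (cs : CoxeterSystem (typeB n) W)
    {W' : Type*} [Group W'] (cs' : CoxeterSystem (typeB' n) W') :
    (∀ w : W, cs.IsFullyCommutative w →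
      (cs.IsNonCancellable w ↔
        cs.IsProdCommGenerators w ∨
        ∃ u : W, cs.IsProdCommGenerators u ∧
          (∀ i ∈ cs.support u, (i : ℕ) ≠ 1 ∧ (i : ℕ) ≠ 2 ∧ (i : ℕ) ≠ 3) ∧
          (w = cs.simple ⟨1, le_refl 1, by lia⟩ * cs.simple ⟨2, by lia, hn⟩ * u ∨
            w = cs.simple ⟨2, by lia, hn⟩ * cs.simple ⟨1, le_refl 1, by lia⟩ * u))) ∧
    (∀ w : W', cs'.IsFullyCommutative w →
      (cs'.IsNonCancellable w ↔
        cs'.IsProdCommGenerators w ∨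
        ∃ u : W', cs'.IsProdCommGenerators u ∧
          (∀ i ∈ cs'.support u, (i : ℕ) ≠ n + 1 ∧ (i : ℕ) ≠ n ∧ (i : ℕ) ≠ n - 1) ∧
          (w = cs'.simple ⟨n + 1, by lia, le_refl _⟩ * cs'.simple ⟨n, hn, by lia⟩ * u ∨
            w = cs'.simple ⟨n, hn, by lia⟩ * cs'.simple ⟨n + 1, by lia, le_refl _⟩ * u))) := by
  refine ⟨fun w _ => CoxeterSystem.isNonCancellable_iff (isPathLabelling_typeB n) rfl rfl w,
    fun w _ => ?_⟩
  rw [CoxeterSystem.isNonCancellable_iff (isPathLabelling_typeB' n)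
    (p := ⟨n + 1, by lia, le_refl _⟩) (q := ⟨n, hn, by lia⟩) (by simp) (by simp) w]
  have key : ∀ i : Set.Icc 2 (n + 1),
      (n + 2 - (i : ℕ) ≠ 1 ∧ n + 2 - (i : ℕ) ≠ 2 ∧ n + 2 - (i : ℕ) ≠ 3) ↔
        ((i : ℕ) ≠ n + 1 ∧ (i : ℕ) ≠ n ∧ (i : ℕ) ≠ n - 1) := by
    intro i
    have h := i.2
    simp only [Set.mem_Icc] at h
    lia
  simp only [key]
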